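/- Throughout, arithmetic on bits is in $\mathbb{F}_2$, $\Delta$ is Hamming distance, $\|\cdot\|$ is Hamming weight, $\circ$ is concatenation, coordinates of words of length $d$ are numbered $0,\dots,d-1$, and $\mathrm{Ber}(p)^m$ is the law of $m$ independent bits that are $1$ with probability $p$. **Base code.** Let $\mathcal{C}\subseteq\mathbb{F}_2^n$ be a linear code of dimension $k\ge 1$ with generator matrix $A\in\mathbb{F}_2^{k\times n}$ (its rows $a_0,\dots,a_{k-1}$ are a basis of $\mathcal{C}$), minimum distance $D=\min_{c\ne c'\in\mathcal{C}}\Delta(c,c')$, encoder $\mathrm{Enc}_{\mathcal{C}}(v)=v^{T}A$, and any decoder $\mathrm{Dec}_{\mathcal{C}}:\mathbb{F}_2^n\to\mathbb{F}_2^k$. Let $P_{\mathrm{fail}}(\mathcal{C})=\max_{v\in\mathbb{F}_2^k}\Pr_{\eta\sim\mathrm{Ber}(p)^n}[\mathrm{Dec}_{\mathcal{C}}(\mathrm{Enc}_{\mathcal{C}}(v)+\eta)\ne v]$. **Building blocks.** The binary reflected code $\mathcal{R}_k:\{0,\dots,2^k-1\}\to\mathbb{F}_2^k$ is the bijection with $\mathcal{R}_1(0)=0$,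 $\mathcal{R}_1(1)=1$, and, for $k>1$, $\mathcal{R}_k(i)=0\circ\mathcal{R}_{k-1}(i)$ if $i<2^{k-1}$ and $\mathcal{R}_k(i)=1\circ\mathcal{R}_{k-1}(2^k-1-i)$ otherwise. For $y\in\mathbb{F}_2^\ell$, $\mathrm{Dec}_{\mathcal{U}}(y)$ is the least $v\in\{0,\dots,\ell\}$ minimizing $\Delta(y,1^v0^{\ell-v})$. $\mathrm{Maj}$ is the majority bit; each tie is decided by an independent fair coin. **Gray code.** Put $c_0=0^n$ and, for $0\le i<2^k-1$, $c_{i+1}=c_i+a_{z_i}$, where $z_i$ is the unique position in which $\mathcal{R}_k(i)$ and $\mathcal{R}_k(i+1)$ differ. Let $d=2n+3D$ and $w_i=W(i,c_i)$, where $W(i,c)=b^D\circ c\circ b^D\circ c\circ b^D$ with $b=i\bmod 2$. Let $r_i=\sum_{\ell=1}^{i}\Delta(w_{\ell-1},w_\ell)$ for $0\le i\le 2^k-1$, and $N=r_{2^k-1}+1$. For $0\le i<2^k-1$ let $h_i=(h_{i,1},h_{i,2},\dots)$ be the increasing list of the positions in which $w_i$ and $w_{i+1}$ differ, without the last one. For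 $j\in\{0,\dots,N-1\}$ define $\mathrm{Enc}_{\mathcal{G}}(j)=g_j\in\mathbb{F}_2^d$ by $g_{r_i}=w_i$ and, for $r_i<j<r_{i+1}$, by letting $g_j$ agree with $w_{i+1}$ on the positions $0,\dots,h_{i,j-r_i}$ and with $w_i$ on the later ones. **Decoder** $\mathrm{Dec}_{\mathcal{G}}$. Split the input $x\in\mathbb{F}_2^d$ as $s_1\circ\tilde c_1\circ s_2\circ\tilde c_2\circ s_3$ with blocks of lengths $D,n,D,n,D$. Let $\hat v_\ell=\mathrm{Dec}_{\mathcal{C}}(\tilde c_\ell)$ for $\ell=1,2$, $b_\ell=\mathrm{Maj}(s_\ell)$ for $\ell=1,2,3$, and $\rho(i)=3Di+\sum_{z=0}^{k-1}2\left\lfloor\frac{i+2^z}{2^{z+1}}\right\rfloor\|a_{k-1-z}\|$. 1. If $(b_1,b_2,b_3)\in\{(1,1,0),(0,0,1)\}$: let $\hat\iota=\mathcal{R}_k^{-1}(\hat v_1)$. If $\hat\iota=0$, return $0$. Otherwise let $\hat c_1=\mathrm{Enc}_{\mathcal{C}}(\mathcal{R}_k(\hat\iota-1))$, $\hat c_2=\mathrm{Enc}_{\mathcal{C}}(\hat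 v_1)$, $\hat w_1=W(\hat\iota-1,\hat c_1)$, let $H'$ be the list of entries of $h_{\hat\iota-1}$ that are $\ge n+D$, and let $u=\mathrm{Dec}_{\mathcal{U}}(x[H']+\hat w_1[H'])$; return $u+D+\Delta(\hat c_1,\hat c_2)+\rho(\hat\iota-1)$. 2. If $(b_1,b_2,b_3)\in\{(0,1,1),(1,0,0)\}$: let $\hat\iota=\mathcal{R}_k^{-1}(\hat v_2)$. If $\hat\iota=2^k-1$, return $0$. Otherwise let $\hat w_1=W(\hat\iota,\mathrm{Enc}_{\mathcal{C}}(\hat v_2))$, let $H'$ be the list of entries of $h_{\hat\iota}$ that are $<n+2D$, and let $u=\mathrm{Dec}_{\mathcal{U}}(x[H']+\hat w_1[H'])$; return $u+\rho(\hat\iota)$. 3. If $b_1=b_2=b_3$: let $\hat\iota=\mathcal{R}_k^{-1}(\hat v_1)$, $u_1=\mathrm{Dec}_{\mathcal{U}}(s_1+b_1^D)$ and $\hat j_1=u_1+\rho(\hat\iota)$. If $\hat\iota=0$, return $\hat j_1$. Otherwise let $\hat c_1=\mathrm{Enc}_{\mathcal{C}}(\mathcal{R}_k(\hat\iota-1))$,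 $\hat c_2=\mathrm{Enc}_{\mathcal{C}}(\hat v_1)$, $u_2=\mathrm{Dec}_{\mathcal{U}}(s_3+\overline{b_1}^D)$ and $\hat j_2=u_2+2D+2\Delta(\hat c_1,\hat c_2)+\rho(\hat\iota-1)$. If $\hat j_1\ge N$, return $\hat j_2$. Otherwise return the $j'\in\{\hat j_1,\hat j_2\}$ that minimizes $\Delta(x,g_{j'})$ (in a tie, $\hat j_1$). 4. If $(b_1,b_2,b_3)\in\{(0,1,0),(1,0,1)\}$, return $0$. **Theorem.** Let $p\in(0,1/2)$, $\alpha=\frac{(1-2p)^2}{4p+2}$ and $\gamma=\frac{2}{1-e^{-\alpha}}$. For every linear code $\mathcal{C}$, generator matrix $A$ and decoder $\mathrm{Dec}_{\mathcal{C}}$ as above, every $j\in\{0,\dots,N-1\}$ and every real $t$, $$\Pr\bigl[\,|j-\mathrm{Dec}_{\mathcal{G}}(\mathrm{Enc}_{\mathcal{G}}(j)+\eta)|>t\,\bigr]\le\gamma e^{-\alpha t}+5\,P_{\mathrm{fail}}(\mathcal{C}),$$ where the probability is over $\eta\sim\mathrm{Ber}(p)^d$ and the tie-breaking coins of the three majority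 votes. -/

import Mathlib

namespace RobustGray

/-! ### Probability

Noise vectors, and the coins used to break ties, are finite bit vectors, so probabilities are
finite sums. -/

/-- The probability mass of a bit vector `η` under `Ber(p)^ι`: independent bits, each equal to
`1` with probability `p` and to `0` with probability `1 - p`. -/
noncomputable def berMass {ι : Type*} [Fintype ι] (p : ℝ) (η : ι → ZMod 2) : ℝ :=
  ∏ i, if η i = 1 then p else 1 - p

open Classical in
/-- The probability of the event `E` for the mass function `μ` on a finite space. -/
noncomputable def prob {Ω : Type*} [Fintype Ω] (μ : Ω → ℝ) (E : Ω → Prop) : ℝ :=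
  ∑ ω ∈ Finset.univ.filter E, μ ω

/-! ### Linear codes -/

/-- `A` is a generator matrix of `C`: its rows are a basis of `C`. -/
def IsGeneratorMatrix {n k : ℕ} (C : Submodule (ZMod 2) (Fin n → ZMod 2))
    (A : Matrix (Fin k) (Fin n) (ZMod 2)) : Prop :=
  LinearIndependent (ZMod 2) A.row ∧ Submodule.span (ZMod 2) (Set.range A.row) = C

/-- The minimum distance `D(C)`. -/
noncomputable def minDist {n : ℕ} (C : Submodule (ZMod 2) (Fin n → ZMod 2)) : ℕ :=
  sInf {m | ∃ c ∈ C, ∃ c' ∈ C, c ≠ c' ∧ hammingDist c c' = m}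

/-- The encoding map of the code with generator matrix `A`. -/
def encC {n k : ℕ} (A : Matrix (Fin k) (Fin n) (ZMod 2)) (v : Fin k → ZMod 2) :
    Fin n → ZMod 2 :=
  Matrix.vecMul v A

/-- The failure probability on the binary symmetric channel: the maximum over all messages `v`
of the probability that `v` is not recovered from `Enc_C(v) + η`, with `η ∼ Ber(p)^n`. -/
noncomputable def pFail {n k : ℕ} (p : ℝ) (A : Matrix (Fin k) (Fin n) (ZMod 2))
    (decC : (Fin n → ZMod 2) → (Fin k → ZMod 2)) : ℝ :=
  ⨆ v : Fin k → ZMod 2, prob (berMass p) fun η : Fin n → ZMod 2 => decC (encC A v + η) ≠ v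

/-! ### Building blocks -/

/-- The binary reflected code `R_k`, meaningful on `{0, …, 2^k - 1}`.
Coordinate `0` is the leading bit. -/
def brc : (k : ℕ) → ℕ → (Fin k → ZMod 2)
  | 0, _ => Fin.elim0
  | k + 1, i =>
    if i < 2 ^ k then Fin.cons 0 (brc k i) else Fin.cons 1 (brc k (2 ^ (k + 1) - 1 - i))

/-- The inverse of the bijection `R_k : {0, …, 2^k - 1} → 𝔽₂^k`. -/
noncomputable def brcInv (k : ℕ) (v : Fin k → ZMod 2) : ℕ :=
  Function.invFunOn (brc k) (Set.Iio (2 ^ k)) v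

/-- The unary code of length `l`: `v ↦ 1^v ∘ 0^(l - v)`. -/
def encU (l v : ℕ) : Fin l → ZMod 2 := fun t => if (t : ℕ) < v then 1 else 0

/-- The unary decoder: a `v ∈ {0, …, l}` (the least one) whose unary codeword is closest to `y`. -/
noncomputable def decU {l : ℕ} (y : Fin l → ZMod 2) : ℕ :=
  sInf {v | v ≤ l ∧ ∀ v' ≤ l, hammingDist y (encU l v) ≤ hammingDist y (encU l v')}

/-- The majority function; a tie is decided by `coin`. -/
def maj {l : ℕ} (coin : ZMod 2) (y : Fin l → ZMod 2) : ZMod 2 :=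
  if l < 2 * hammingNorm y then 1 else if 2 * hammingNorm y < l then 0 else coin

/-! ### The construction

`D` stands for the minimum distance of the base code, and `d = 2 n + 3 D`. -/

/-- The string `b^D ∘ c ∘ b^D ∘ c ∘ b^D`. -/
def wordW {n : ℕ} (D : ℕ) (b : ZMod 2) (c : Fin n → ZMod 2) : Fin (2 * n + 3 * D) → ZMod 2 :=
  fun t =>
    if _ : (t : ℕ) < D then b
    else if _ : (t : ℕ) < D + n then c ⟨t - D, by omega⟩
    else if _ : (t : ℕ) < 2 * D + n then b
    else if _ : (t : ℕ) < 2 * D + 2 * n then c ⟨t - (2 * D + n), by omega⟩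
    else b

open Classical in
/-- The ordering `c_0, c_1, …, c_{2^k - 1}` of the base code: `c_0 = 0`, and `c_{i+1}` is `c_i`
plus the row of `A` with index `z_i`, the position in which `R_k(i)` and `R_k(i+1)` differ. -/
noncomputable def cSeq {n k : ℕ} (A : Matrix (Fin k) (Fin n) (ZMod 2)) : ℕ → (Fin n → ZMod 2)
  | 0 => 0
  | i + 1 =>
    if h : ∃ z, brc k i z ≠ brc k (i + 1) z then cSeq A i + A.row h.choose else cSeq A i

/-- The ordered intermediate code `w_0, …, w_{2^k - 1}`. -/
noncomputable def wSeq {n k : ℕ} (D : ℕ) (A : Matrix (Fin k) (Fin n) (ZMod 2)) (i : ℕ) :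
    Fin (2 * n + 3 * D) → ZMod 2 :=
  wordW D (i : ZMod 2) (cSeq A i)

/-- `r_i = ∑_{l = 1}^{i} Δ(w_{l-1}, w_l)`. -/
noncomputable def rSeq {n k : ℕ} (D : ℕ) (A : Matrix (Fin k) (Fin n) (ZMod 2)) (i : ℕ) : ℕ :=
  ∑ l ∈ Finset.range i, hammingDist (wSeq D A l) (wSeq D A (l + 1))

/-- The number `N` of codewords of the Gray code, which runs from `w_0` through `w_{2^k - 1}`:
the codewords are `g_0, …, g_{N-1}`, and `N - 1 = r_{2^k - 1}`. -/
noncomputable def sizeG {n k : ℕ} (D : ℕ) (A : Matrix (Fin k) (Fin n) (ZMod 2)) : ℕ :=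
  rSeq D A (2 ^ k - 1) + 1

/-- The vector `h_i` of all positions in which `w_i` and `w_{i+1}` differ, in increasing order,
except for the last one. -/
noncomputable def hIdx {n k : ℕ} (D : ℕ) (A : Matrix (Fin k) (Fin n) (ZMod 2)) (i : ℕ) :
    List (Fin (2 * n + 3 * D)) :=
  ((List.finRange (2 * n + 3 * D)).filter fun t => wSeq D A i t ≠ wSeq D A (i + 1) t).dropLast

/-- The crossover point `h_{i,m}`: the `m`-th entry (counting from `1`) of `h_i`. -/
noncomputable def hPos {n k : ℕ} (D : ℕ) (A : Matrix (Fin k) (Fin n) (ZMod 2)) (i m : ℕ) : ℕ :=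
  ((hIdx D A i).map fun t => (t : ℕ)).getD (m - 1) 0

/-- The index `i ∈ {0, …, 2^k - 1}` of the block containing `j`: the largest one with
`r_i ≤ j`, so that `j ∈ [r_i, r_{i+1})`. -/
noncomputable def blockG {n k : ℕ} (D : ℕ) (A : Matrix (Fin k) (Fin n) (ZMod 2)) (j : ℕ) : ℕ :=
  Nat.findGreatest (fun i => rSeq D A i ≤ j) (2 ^ k - 1)

/-- The encoding map `j ↦ g_j` of the robust Gray code, meaningful for `j ∈ {0, …, N - 1}`. -/
noncomputable def encG {n k : ℕ} (D : ℕ) (A : Matrix (Fin k) (Fin n) (ZMod 2)) (j : ℕ) :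
    Fin (2 * n + 3 * D) → ZMod 2 :=
  let i := blockG D A j
  if j = rSeq D A i then wSeq D A i
  else fun t =>
    if (t : ℕ) ≤ hPos D A i (j - rSeq D A i) then wSeq D A (i + 1) t else wSeq D A i t

/-! ### The decoder -/

/-- The substring of length `l` of `x` starting at position `a`. -/
def sub {m : ℕ} (a l : ℕ) (h : a + l ≤ m) (x : Fin m → ZMod 2) : Fin l → ZMod 2 :=
  fun t => x ⟨a + t, by omega⟩

section Chunks

variable {n D : ℕ} (x : Fin (2 * n + 3 * D) → ZMod 2)

/-- The chunk `s_1`. -/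
def s1 : Fin D → ZMod 2 := sub 0 D (by omega) x

/-- The chunk `c̃_1`. -/
def c1 : Fin n → ZMod 2 := sub D n (by omega) x

/-- The chunk `s_2`. -/
def s2 : Fin D → ZMod 2 := sub (D + n) D (by omega) x

/-- The chunk `c̃_2`. -/
def c2 : Fin n → ZMod 2 := sub (2 * D + n) n (by omega) x

/-- The chunk `s_3`. -/
def s3 : Fin D → ZMod 2 := sub (2 * D + 2 * n) D (by omega) x

end Chunks

/-- The restriction `x[H]` of `x` to the positions listed in `H`. -/
def restrict {m : ℕ} (H : List (Fin m)) (x : Fin m → ZMod 2) : Fin H.length → ZMod 2 :=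
  fun t => x (H.get t)

/-- The subroutine `compute-r`. The bit of `R_k` with `z` bits after it, which belongs to row
`k - 1 - z` of `A`, is flipped `⌊(i + 2^z) / 2^(z+1)⌋` times on the way from `R_k(0)` to
`R_k(i)`. -/
def computeR {n k : ℕ} (D : ℕ) (A : Matrix (Fin k) (Fin n) (ZMod 2)) (i : ℕ) : ℕ :=
  (∑ z : Fin k, 2 * ((i + 2 ^ (z : ℕ)) / 2 ^ ((z : ℕ) + 1)) * hammingNorm (A.row z.rev)) +
    3 * D * i

/-- Case 1 of the decoder: the second codeword is decoded to `v₁`, which should be `R_k(i+1)`.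
(If it is `R_k(0)`, there is no preceding codeword, and the output is `0`.) -/
noncomputable def decCase1 {n k : ℕ} (D : ℕ) (A : Matrix (Fin k) (Fin n) (ZMod 2))
    (x : Fin (2 * n + 3 * D) → ZMod 2) (v₁ : Fin k → ZMod 2) : ℕ :=
  let ι := brcInv k v₁
  if ι = 0 then 0
  else
    let c₁ := encC A (brc k (ι - 1))
    let c₂ := encC A v₁
    let w₁ := wordW D ((ι - 1 : ℕ) : ZMod 2) c₁
    let H := (hIdx D A (ι - 1)).filter fun l : Fin (2 * n + 3 * D) => n + D ≤ (l : ℕ)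
    let u := decU (restrict H x + restrict H w₁)
    u + D + hammingDist c₁ c₂ + computeR D A (ι - 1)

/-- Case 2 of the decoder: the first codeword is decoded to `v₂`, which should be `R_k(i)`.
(If it is `R_k(2^k - 1)`, there is no following codeword, and the output is `0`.) -/
noncomputable def decCase2 {n k : ℕ} (D : ℕ) (A : Matrix (Fin k) (Fin n) (ZMod 2))
    (x : Fin (2 * n + 3 * D) → ZMod 2) (v₂ : Fin k → ZMod 2) : ℕ :=
  let ι := brcInv k v₂
  if ι = 2 ^ k - 1 then 0
  else
    let c₁ := encC A v₂
    let w₁ := wordW D (ι : ZMod 2) c₁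
    let H := (hIdx D A ι).filter fun l : Fin (2 * n + 3 * D) => (l : ℕ) < n + 2 * D
    let u := decU (restrict H x + restrict H w₁)
    u + computeR D A ι

/-- Case 3 of the decoder: two estimates `j₁`, `j₂` are computed, and the one whose codeword is
closer to `x` is returned. An estimate that does not exist (there is no `j₂` for `ι = 0`) or is
not in `{0, …, N - 1}` (which can only happen to `j₁`) is discarded. -/
noncomputable def decCase3 {n k : ℕ} (D : ℕ) (A : Matrix (Fin k) (Fin n) (ZMod 2))
    (x : Fin (2 * n + 3 * D) → ZMod 2) (b₁ : ZMod 2) (v₁ : Fin k → ZMod 2) : ℕ :=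
  let ι := brcInv k v₁
  let u₁ := decU (s1 x + fun _ => b₁)
  let j₁ := u₁ + computeR D A ι
  if ι = 0 then j₁
  else
    let c₁ := encC A (brc k (ι - 1))
    let c₂ := encC A v₁
    let u₂ := decU (s3 x + fun _ => b₁ + 1)
    let j₂ := u₂ + 2 * D + 2 * hammingDist c₁ c₂ + computeR D A (ι - 1)
    if sizeG D A ≤ j₁ then j₂
    else if hammingDist x (encG D A j₁) ≤ hammingDist x (encG D A j₂) then j₁ else j₂

/-- The decoder of the robust Gray code. The three bits `coin` decide the ties of the three
majority votes. (On the two patterns `(0,1,0)` and `(1,0,1)` the output is `0`.) -/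
noncomputable def decG {n k : ℕ} (D : ℕ) (A : Matrix (Fin k) (Fin n) (ZMod 2))
    (decC : (Fin n → ZMod 2) → (Fin k → ZMod 2)) (coin : Fin 3 → ZMod 2)
    (x : Fin (2 * n + 3 * D) → ZMod 2) : ℕ :=
  let v₁ := decC (c1 x)
  let v₂ := decC (c2 x)
  let b₁ := maj (coin 0) (s1 x)
  let b₂ := maj (coin 1) (s2 x)
  let b₃ := maj (coin 2) (s3 x)
  if (b₁, b₂, b₃) = (1, 1, 0) ∨ (b₁, b₂, b₃) = (0, 0, 1) then decCase1 D A x v₁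
  else if (b₁, b₂, b₃) = (0, 1, 1) ∨ (b₁, b₂, b₃) = (1, 0, 0) then decCase2 D A x v₂
  else if (b₁, b₂, b₃) = (0, 0, 0) ∨ (b₁, b₂, b₃) = (1, 1, 1) then decCase3 D A x b₁ v₁
  else 0

/-- The probability that the decoder of the Gray code errs by more than `t` on the index `j`,
over the noise `η ∼ Ber(p)^d` and three independent fair tie-breaking coins. -/
noncomputable def errProb {n k : ℕ} (p : ℝ) (D : ℕ) (A : Matrix (Fin k) (Fin n) (ZMod 2))
    (decC : (Fin n → ZMod 2) → (Fin k → ZMod 2)) (j : ℕ) (t : ℝ) : ℝ :=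
  prob
    (fun ω : (Fin (2 * n + 3 * D) → ZMod 2) × (Fin 3 → ZMod 2) =>
      berMass p ω.1 * berMass (1 / 2) ω.2)
    fun ω => t < |(j : ℝ) - (decG D A decC ω.2 (encG D A j + ω.1) : ℝ)|

end RobustGray

/-!
Write `x = g_j + η`. Besides `w_i`, the codewords are cuts: up to a crossover position `q` the word
is `w_{i+1}`, and from there on it is `w_i`; the index of the cut is `r_i` plus the number of
differences of `w_i` and `w_{i+1}` before `q` (`encG_add_blockCount`). So two cuts of the same pair
of words are at distance `|j - j'|`, and the same holds across `w_i` when the crossovers lie in the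
last and in the first repetition block (`hammingDist_blockCut_succ`).

Only one of the five blocks of `g_j` contains the crossover. If the majority votes and the base
decoder succeed on the other blocks, then the decoder knows `i`, and every unary decoding it
carries out finds a closest word to `x` among the cuts in some range (`exists_cut_eq_decU`). In each
case `g_j` is one of the words the output `j'` is compared with, so that `g_{j'}` is at least as
close to `x` as `g_j`, while `Δ(g_j, g_{j'}) = |j - j'|` (`decG_isGoodEstimate`). This uses that
`ρ(i) = r_i` (`computeR_eq_rSeq`), which rests on a closed form for the bits of the binary
reflected code (`brc_apply`).

The probability is then bounded by a union bound over the following events.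
* One of at most five blocks is decoded wrongly. For the base decoder this costs `P_fail` by
  definition. For a majority vote on `D` bits it costs at most `P_fail` too, since the vote is the
  optimal test between two codewords at distance `D` (`prob_maj_add_prob_maj_le`).
* Some `j'` with `|j - j'| = Δ(g_j, g_{j'}) > t` has `g_{j'}` at least as close to `x` as `g_j`. For
  one `j'` this has probability at most `(2 √(p (1 - p)))^|j - j'| ≤ e^(-α |j - j'|)`
  (`prob_shift_closer_le`), and the sum of a two-sided geometric tail is at most `γ e^(-α t)`
  (`sum_exp_dist_le`).
-/

namespace RobustGray

/-! ### Finite probability -/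

open Classical in
theorem prob_eq_sum {Ω : Type*} [Fintype Ω] (μ : Ω → ℝ) (E : Ω → Prop) :
    prob μ E = ∑ ω, if E ω then μ ω else 0 := by
  rw [prob, Finset.sum_filter]

theorem prob_mono {Ω : Type*} [Fintype Ω] {μ : Ω → ℝ} (hμ : ∀ ω, 0 ≤ μ ω) {E F : Ω → Prop}
    (h : ∀ ω, E ω → F ω) : prob μ E ≤ prob μ F := by
  classical
  rw [prob_eq_sum, prob_eq_sum]
  refine Finset.sum_le_sum fun ω _ => ?_
  by_cases hE : E ω
  · simp [hE, h ω hE]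
  · simp only [hE, if_false]
    split_ifs <;> simp [hμ ω]

theorem prob_nonneg {Ω : Type*} [Fintype Ω] {μ : Ω → ℝ} (hμ : ∀ ω, 0 ≤ μ ω) (E : Ω → Prop) :
    0 ≤ prob μ E :=
  Finset.sum_nonneg fun ω _ => hμ ω

theorem prob_le_sum {Ω : Type*} [Fintype Ω] {μ : Ω → ℝ} (hμ : ∀ ω, 0 ≤ μ ω) (E : Ω → Prop) :
    prob μ E ≤ ∑ ω, μ ω := by
  classical
  exact Finset.sum_le_sum_of_subset_of_nonneg (Finset.filter_subset _ _) fun ω _ _ => hμ ω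

theorem prob_or_le {Ω : Type*} [Fintype Ω] {μ : Ω → ℝ} (hμ : ∀ ω, 0 ≤ μ ω) (E F : Ω → Prop) :
    prob μ (fun ω => E ω ∨ F ω) ≤ prob μ E + prob μ F := by
  classical
  simp only [prob_eq_sum, ← Finset.sum_add_distrib]
  refine Finset.sum_le_sum fun ω _ => ?_
  by_cases hE : E ω <;> by_cases hF : F ω <;> simp [hE, hF, hμ ω]

theorem prob_exists_le {Ω κ : Type*} [Fintype Ω] {μ : Ω → ℝ} (hμ : ∀ ω, 0 ≤ μ ω)
    (s : Finset κ) (E : κ → Ω → Prop) :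
    prob μ (fun ω => ∃ i ∈ s, E i ω) ≤ ∑ i ∈ s, prob μ (E i) := by
  classical
  induction s using Finset.induction_on with
  | empty => simp [prob]
  | insert a s ha ih =>
    rw [Finset.sum_insert ha]
    refine le_trans (le_of_eq ?_) ((prob_or_le hμ (E a) _).trans (add_le_add_right ih _))
    congr 1
    ext ω
    simp

/-- Fubini's theorem for the product of two mass functions. -/
theorem prob_prod {Ω Ω' : Type*} [Fintype Ω] [Fintype Ω'] (μ : Ω → ℝ) (ν : Ω' → ℝ)
    (E : Ω × Ω' → Prop) :
    prob (fun ω : Ω × Ω' => μ ω.1 * ν ω.2) E = ∑ c, ν c * prob μ fun ω => E (ω, c) := by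
  classical
  simp only [prob_eq_sum, Fintype.sum_prod_type_right, Finset.mul_sum]
  refine Finset.sum_congr rfl fun c _ => Finset.sum_congr rfl fun ω _ => ?_
  split_ifs <;> ring

theorem prob_prod_fst {Ω Ω' : Type*} [Fintype Ω] [Fintype Ω'] (μ : Ω → ℝ) {ν : Ω' → ℝ}
    (hν : ∑ c, ν c = 1) (E : Ω → Prop) :
    prob (fun ω : Ω × Ω' => μ ω.1 * ν ω.2) (fun ω => E ω.1) = prob μ E := by
  rw [prob_prod]
  exact (Finset.sum_mul _ ν (prob μ E)).symm.trans (by rw [hν, one_mul])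

/-! ### Bernoulli noise -/

theorem vec_add_self {ι : Type*} (δ : ι → ZMod 2) : δ + δ = 0 := by
  funext i
  exact CharTwo.add_self_eq_zero _

section Bernoulli

variable {ι κ : Type*} [Fintype ι] [Fintype κ] {p : ℝ}

theorem berMass_nonneg (h0 : 0 ≤ p) (h1 : p ≤ 1) (η : ι → ZMod 2) : 0 ≤ berMass p η :=
  Finset.prod_nonneg fun i _ => by split_ifs <;> linarith

/-- A sum over bit vectors of products over the coordinates factors. -/
theorem sum_prod_bits [DecidableEq ι] (f : ι → ZMod 2 → ℝ) :
    ∑ η : ι → ZMod 2, ∏ i, f i (η i) = ∏ i, (f i 0 + f i 1) := by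
  have h : ∀ i, f i 0 + f i 1 = ∑ b : ZMod 2, f i b := fun i => (Fin.sum_univ_two (f i)).symm
  simp only [h, Finset.prod_univ_sum, Fintype.piFinset_univ]

theorem sum_berMass [DecidableEq ι] (p : ℝ) : ∑ η : ι → ZMod 2, berMass p η = 1 := by
  unfold berMass
  rw [sum_prod_bits fun _ b => if b = 1 then p else 1 - p]
  simp

/-- The restriction of Bernoulli noise to a set of coordinates is Bernoulli noise. -/
theorem prob_berMass_comp [DecidableEq ι] [DecidableEq κ] {e : κ → ι}
    (he : Function.Injective e) (E : (κ → ZMod 2) → Prop) :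
    prob (berMass p) (fun η : ι → ZMod 2 => E (η ∘ e)) = prob (berMass p) E := by
  classical
  let σ : κ ⊕ ↥(Set.range e)ᶜ ≃ ι :=
    (Equiv.sumCongr (Equiv.ofInjective e he) (Equiv.refl _)).trans
      (Equiv.Set.sumCompl (Set.range e))
  let τ : (κ → ZMod 2) × (↥(Set.range e)ᶜ → ZMod 2) ≃ (ι → ZMod 2) :=
    (Equiv.sumArrowEquivProdArrow _ _ _).symm.trans (σ.arrowCongr (Equiv.refl _))
  have hσ : ∀ s, σ (Sum.inl s) = e s := fun s => by simp [σ]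
  have hτ : ∀ a, τ a = Sum.elim a.1 a.2 ∘ σ.symm := fun a => rfl
  have hcomp : ∀ a, τ a ∘ e = a.1 := fun a => by
    funext s
    rw [hτ, Function.comp_apply, Function.comp_apply, ← hσ, σ.symm_apply_apply, Sum.elim_inl]
  have hmass : ∀ a, berMass p (τ a) = berMass p a.1 * berMass p a.2 := fun a => by
    simp only [berMass]
    rw [← σ.prod_comp, Fintype.prod_sum_type]
    simp [hτ]
  simp only [prob_eq_sum]
  rw [← τ.sum_comp, Fintype.sum_prod_type]
  refine Finset.sum_congr rfl fun a _ => ?_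
  simp only [hcomp, hmass]
  split_ifs with h
  · rw [← Finset.mul_sum, sum_berMass, mul_one]
  · simp

theorem berMass_eq_pow (η : ι → ZMod 2) :
    berMass p η = p ^ hammingNorm η * (1 - p) ^ (Fintype.card ι - hammingNorm η) := by
  classical
  have h01 : ∀ b : ZMod 2, b = 1 ↔ b ≠ 0 := by decide
  simp only [berMass, Finset.prod_ite, Finset.prod_const, h01]
  congr 2
  rw [hammingNorm, ← Finset.card_compl]
  congr 1
  ext i
  simp

/-- For `p ≤ 1/2`, lighter noise vectors are more likely. -/
theorem berMass_le_of_hammingNorm_le (h0 : 0 < p) (h1 : p ≤ 1 / 2) {η η' : ι → ZMod 2}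
    (h : hammingNorm η' ≤ hammingNorm η) : berMass p η ≤ berMass p η' := by
  rw [berMass_eq_pow, berMass_eq_pow]
  have hc : hammingNorm η ≤ Fintype.card ι := hammingNorm_le_card_fintype
  obtain ⟨a, ha⟩ := Nat.exists_eq_add_of_le h
  obtain ⟨b, hb⟩ := Nat.exists_eq_add_of_le hc
  rw [hb, show hammingNorm η + b - hammingNorm η = b by omega,
    show hammingNorm η + b - hammingNorm η' = a + b by omega, ha, pow_add, pow_add, mul_assoc]
  have hb0 : 0 ≤ (1 - p) ^ b := pow_nonneg (by linarith) b
  gcongr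
  linarith

theorem prob_berMass_add (δ : ι → ZMod 2) [DecidableEq ι] (E : (ι → ZMod 2) → Prop) :
    prob (berMass p) E = prob (fun η => berMass p (η + δ)) fun η => E (η + δ) := by
  classical
  rw [prob_eq_sum, prob_eq_sum]
  exact (Equiv.sum_comp (Equiv.addRight δ) fun η => if E η then berMass p η else 0).symm

/-- The Bhattacharyya bound for two words at distance `‖δ‖`: noise under which the word shifted
by `δ` is at least as close as the transmitted word has probability at most
`(2 √(p (1 - p)))^‖δ‖`. -/
theorem prob_shift_closer_le [DecidableEq ι] (h0 : 0 < p) (h1 : p ≤ 1 / 2) (δ : ι → ZMod 2) :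
    prob (berMass p) (fun η : ι → ZMod 2 => hammingNorm (η + δ) ≤ hammingNorm η) ≤
      (2 * √(p * (1 - p))) ^ hammingNorm δ := by
  classical
  have hm : ∀ b : ZMod 2, 0 ≤ (if b = 1 then p else 1 - p) := fun b => by
    split_ifs <;> linarith
  have h01 : ∀ b : ZMod 2, b ≠ 0 → b = 1 := by decide
  calc prob (berMass p) (fun η : ι → ZMod 2 => hammingNorm (η + δ) ≤ hammingNorm η)
      ≤ ∑ η : ι → ZMod 2, √(berMass p η * berMass p (η + δ)) := by
        rw [prob_eq_sum]
        refine Finset.sum_le_sum fun η _ => ?_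
        split_ifs with h
        · refine Real.le_sqrt_of_sq_le ?_
          rw [sq]
          exact mul_le_mul_of_nonneg_left (berMass_le_of_hammingNorm_le h0 h1 h)
            (berMass_nonneg h0.le (by linarith) _)
        · positivity
    _ = ∑ η : ι → ZMod 2, ∏ i,
          √((if η i = 1 then p else 1 - p) * (if η i + δ i = 1 then p else 1 - p)) := by
        refine Finset.sum_congr rfl fun η _ => ?_
        rw [berMass, berMass, ← Finset.prod_mul_distrib]
        exact Real.sqrt_prod _ fun i _ => mul_nonneg (hm _) (hm _)
    _ = ∏ i, if δ i ≠ 0 then 2 * √(p * (1 - p)) else 1 := by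
        rw [sum_prod_bits fun i b =>
          √((if b = 1 then p else 1 - p) * (if b + δ i = 1 then p else 1 - p))]
        refine Finset.prod_congr rfl fun i _ => ?_
        by_cases hi : δ i = 0
        · simp only [hi, add_zero, ne_eq, not_true_eq_false, if_false, zero_ne_one, if_true]
          rw [Real.sqrt_mul_self (by linarith), Real.sqrt_mul_self h0.le]
          ring
        · have h11 : (1 : ZMod 2) + 1 = 0 := by decide
          simp only [h01 _ hi, zero_add, h11, zero_ne_one, if_true, if_false, ne_eq,
            one_ne_zero, not_false_eq_true]
          rw [mul_comm (1 - p) p]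
          ring
    _ = (2 * √(p * (1 - p))) ^ hammingNorm δ := by
        rw [Finset.prod_ite, Finset.prod_const, Finset.prod_const_one, mul_one]
        rfl

theorem two_mul_sqrt_le_exp (h0 : 0 < p) (h1 : p < 1 / 2) :
    2 * √(p * (1 - p)) ≤ Real.exp (-((1 - 2 * p) ^ 2 / (4 * p + 2))) := by
  have hpp : 0 ≤ p * (1 - p) := mul_nonneg h0.le (by linarith)
  refine le_trans (b := Real.exp (-((1 - 2 * p) ^ 2 / 2))) ?_ ?_
  · refine abs_le_of_sq_le_sq' (?_) (Real.exp_pos _).le |>.2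
    rw [mul_pow, Real.sq_sqrt hpp, ← Real.exp_nat_mul]
    have := Real.add_one_le_exp (((2 : ℕ) : ℝ) * -((1 - 2 * p) ^ 2 / 2))
    refine le_trans (le_of_eq ?_) this
    push_cast
    ring
  · rw [Real.exp_le_exp, neg_le_neg_iff]
    exact div_le_div_of_nonneg_left (sq_nonneg _) (by norm_num) (by linarith)

end Bernoulli

/-- A two-sided geometric tail: the sum over all `j'` further than `t` from `j`. -/
theorem sum_exp_dist_le {α t : ℝ} (hα : 0 < α) (ht : 0 ≤ t) (j : ℕ) (s : Finset ℕ)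
    (hs : ∀ j' ∈ s, t < |(j : ℝ) - j'|) :
    ∑ j' ∈ s, Real.exp (-α) ^ (((j : ℤ) - j').natAbs) ≤
      2 / (1 - Real.exp (-α)) * Real.exp (-(α * t)) := by
  classical
  set x := Real.exp (-α) with hx
  have hx0 : 0 < x := Real.exp_pos _
  have hx1 : x < 1 := (Real.exp_lt_one_iff).2 (by linarith)
  have habs : ∀ j' : ℕ, |(j : ℝ) - j'| = (((j : ℤ) - j').natAbs : ℝ) := fun j' => by
    rw [Nat.cast_natAbs]; push_cast; rfl
  -- each distance is attained at most once on either side of `j`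
  have key : ∀ u : Finset ℕ, (∀ j' ∈ u, t < |(j : ℝ) - j'|) →
      Set.InjOn (fun j' : ℕ => ((j : ℤ) - j').natAbs) u →
      ∑ j' ∈ u, x ^ (((j : ℤ) - j').natAbs) ≤ Real.exp (-(α * t)) / (1 - x) := by
    intro u hu hinj
    rw [← Finset.sum_image (f := fun m => x ^ m) hinj]
    set m₀ := ⌊t⌋₊ + 1
    have hsub : u.image (fun j' : ℕ => ((j : ℤ) - j').natAbs) ⊆
        (Finset.range ((u.image (fun j' : ℕ => ((j : ℤ) - j').natAbs)).sup id + 1)).image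
          (fun a => m₀ + a) := by
      intro m hm
      have hle : m ≤ _ := Finset.le_sup (f := id) hm
      obtain ⟨j', hj', rfl⟩ := Finset.mem_image.1 hm
      have h1 := hu j' hj'
      rw [habs] at h1
      have h2 := (Nat.floor_lt ht).2 h1
      refine Finset.mem_image.2 ⟨((j : ℤ) - j').natAbs - m₀, ?_, by omega⟩
      rw [Finset.mem_range]
      beta_reduce at hle
      omega
    refine (Finset.sum_le_sum_of_subset_of_nonneg hsub fun _ _ _ => by positivity).trans ?_
    rw [Finset.sum_image (fun a _ b _ h => by simpa using h)]
    simp only [pow_add]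
    rw [← Finset.mul_sum, div_eq_mul_inv]
    refine mul_le_mul ?_ ?_ (Finset.sum_nonneg fun _ _ => by positivity) (Real.exp_pos _).le
    · rw [← Real.exp_nat_mul, Real.exp_le_exp]
      have := Nat.lt_floor_add_one t
      push_cast [m₀]
      nlinarith
    · rw [← tsum_geometric_of_lt_one hx0.le hx1]
      exact (summable_geometric_of_lt_one hx0.le hx1).sum_le_tsum _ fun _ _ => by positivity
  have hsplit := Finset.sum_filter_add_sum_filter_not s (fun j' => j < j')
    (fun j' => x ^ (((j : ℤ) - j').natAbs))
  rw [← hsplit]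
  have h1 := key (s.filter fun j' => j < j') (fun j' h => hs j' (Finset.mem_filter.1 h).1) (by
    intro a ha b hb hab
    have := (Finset.mem_filter.1 ha).2
    have := (Finset.mem_filter.1 hb).2
    beta_reduce at hab
    omega)
  have h2 := key (s.filter fun j' => ¬ j < j') (fun j' h => hs j' (Finset.mem_filter.1 h).1) (by
    intro a ha b hb hab
    have := (Finset.mem_filter.1 ha).2
    have := (Finset.mem_filter.1 hb).2
    beta_reduce at hab
    omega)
  calc _ ≤ _ := add_le_add h1 h2
    _ = _ := by ring

/-! ### Majority votes on repetition blocks -/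

theorem hammingNorm_add_one {l : ℕ} (η : Fin l → ZMod 2) :
    hammingNorm (η + 1) + hammingNorm η = l := by
  have h : ∀ b : ZMod 2, b + 1 ≠ 0 ↔ ¬ b ≠ 0 := by decide
  rw [hammingNorm, hammingNorm, add_comm]
  simp only [Pi.add_apply, Pi.one_apply, h]
  rw [Finset.card_filter_add_card_filter_not, Finset.card_fin]

theorem maj_add_one {l : ℕ} (c : ZMod 2) (η : Fin l → ZMod 2) :
    maj c (η + 1) = maj (c + 1) η + 1 := by
  have h := hammingNorm_add_one η
  have h2 : ∀ c : ZMod 2, c + 1 + 1 = c := by decide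
  unfold maj
  split_ifs <;> first | omega | rfl | exact (h2 c).symm

theorem maj_shift_ne_iff {l : ℕ} (c b : ZMod 2) (η : Fin l → ZMod 2) :
    maj c (fun s => b + η s) ≠ b ↔ maj (c + b) η = 1 := by
  have hb : b = 0 ∨ b = 1 := by revert b; decide
  rcases hb with rfl | rfl
  · have : ∀ m : ZMod 2, m ≠ 0 ↔ m = 1 := by decide
    simp [this]
  · have : ∀ m : ZMod 2, m + 1 ≠ 1 ↔ m = 1 := by decide
    rw [show (fun s => 1 + η s) = η + 1 from funext fun s => add_comm _ _, maj_add_one]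
    exact this _

/-- A majority vote on `D` noisy bits is the optimal test between two words at distance `D`.
Hence its two kinds of error, with the coin `b` deciding ties, sum up to at most the sum of the
two error probabilities of any other test (which errs on `c` on the set `T`, and on `c'` on the
set `T'`). -/
theorem prob_maj_add_prob_maj_le {p : ℝ} (h0 : 0 < p) (h1 : p ≤ 1 / 2) {n D : ℕ}
    (c c' : Fin n → ZMod 2) (hD : hammingDist c c' = D) (T T' : (Fin n → ZMod 2) → Prop)
    (hT : ∀ y, T y ∨ T' y) (b : ZMod 2) :
    prob (berMass p) (fun η : Fin D → ZMod 2 => maj b η = 1) +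
        prob (berMass p) (fun η : Fin D → ZMod 2 => maj (b + 1) η = 1) ≤
      prob (berMass p) (fun η => T (c + η)) + prob (berMass p) (fun η => T' (c' + η)) := by
  classical
  have h01 : ∀ b : ZMod 2, b ≠ 0 ↔ b = 1 := by decide
  set δ := c + c' with hδ
  set S : Finset (Fin n) := Finset.univ.filter fun t => c t ≠ c' t with hS
  have hSD : S.card = D := hD
  let e : Fin D → Fin n := S.orderEmbOfFin hSD
  have he : Function.Injective e := (S.orderEmbOfFin hSD).injective
  have hrange : Finset.univ.image e = S := by
    rw [← Finset.coe_inj, Finset.coe_image, Finset.coe_univ, Set.image_univ]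
    exact S.range_orderEmbOfFin hSD
  have hδS : ∀ t, δ t = if t ∈ S then 1 else 0 := fun t => by
    have : ∀ a b : ZMod 2, a + b = if a ≠ b then 1 else 0 := by decide
    simp [hδ, hS, this]
  have hδe : ∀ s, δ (e s) = 1 := fun s => by
    rw [hδS, if_pos (hrange ▸ Finset.mem_image_of_mem e (Finset.mem_univ s))]
  have hcomp : ∀ η : Fin n → ZMod 2, (η + δ) ∘ e = η ∘ e + 1 := fun η => by
    funext s
    simp [hδe]
  have hshift : ∀ η, c' + (η + δ) = c + η := fun η => by
    have := vec_add_self c'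
    calc c' + (η + δ) = c + η + (c' + c') := by rw [hδ]; abel
      _ = c + η := by rw [this, add_zero]
  -- adding `δ` flips the `D` bits on `S`
  have hw : ∀ η : Fin n → ZMod 2,
      hammingNorm (η + δ) + 2 * hammingNorm (η ∘ e) = hammingNorm η + D := fun η => by
    have hnorm : ∀ ξ : Fin n → ZMod 2, hammingNorm ξ = ∑ t, if ξ t ≠ 0 then 1 else 0 :=
      fun ξ => by rw [hammingNorm, Finset.card_filter]
    have he' : hammingNorm (η ∘ e) = ∑ t, if t ∈ S ∧ η t ≠ 0 then 1 else 0 := by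
      simp only [ite_and]
      rw [Finset.sum_ite_mem, Finset.univ_inter, ← hrange,
        Finset.sum_image fun _ _ _ _ h => he h, hammingNorm, Finset.card_filter]
      rfl
    have hDS : D = ∑ t, if t ∈ S then 1 else 0 := by simp [hSD]
    rw [hnorm, hnorm, he', Finset.mul_sum]
    conv_rhs => rw [hDS]
    rw [← Finset.sum_add_distrib, ← Finset.sum_add_distrib]
    refine Finset.sum_congr rfl fun t _ => ?_
    have : ∀ b : ZMod 2, b + 1 ≠ 0 ↔ ¬ b ≠ 0 := by decide
    rw [Pi.add_apply, hδS]
    by_cases ht : t ∈ S <;> by_cases hη : η t = 0 <;> simp [ht, hη, this]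
  rw [← prob_berMass_comp he, ← prob_berMass_comp he,
    prob_berMass_add δ fun η : Fin n → ZMod 2 => maj (b + 1) (η ∘ e) = 1,
    prob_berMass_add δ fun η => T' (c' + η)]
  simp only [prob_eq_sum, ← Finset.sum_add_distrib, hcomp, hshift, maj_add_one]
  refine Finset.sum_le_sum fun η _ => ?_
  have hpos := berMass_nonneg (p := p) h0.le (by linarith) η
  have hpos' := berMass_nonneg (p := p) h0.le (by linarith) (η + δ)
  have hlow : maj b (η ∘ e) = 1 → berMass p η ≤ berMass p (η + δ) := fun h => by
    refine berMass_le_of_hammingNorm_le h0 h1 ?_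
    have h2 : D ≤ 2 * hammingNorm (η ∘ e) := by
      by_contra hlt
      rw [maj, if_neg (by omega), if_pos (by omega)] at h
      exact absurd h (by decide)
    have := hw η
    omega
  have hhigh : maj b (η ∘ e) ≠ 1 → berMass p (η + δ) ≤ berMass p η := fun h => by
    refine berMass_le_of_hammingNorm_le h0 h1 ?_
    have h2 : 2 * hammingNorm (η ∘ e) ≤ D := by
      by_contra hlt
      exact h (by rw [maj, if_pos (by omega)])
    have := hw η
    omega
  have h3 : b + 1 + 1 = b := (by decide : ∀ b : ZMod 2, b + 1 + 1 = b) b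
  have h4 : ∀ m : ZMod 2, m + 1 = 1 ↔ ¬ m = 1 := by decide
  simp only [h3, h4]
  by_cases hm : maj b (η ∘ e) = 1
  · have := hlow hm
    rcases hT (c + η) with h | h <;> simp only [hm, h, if_true, not_true_eq_false, if_false] <;>
      split_ifs <;> linarith
  · have := hhigh hm
    rcases hT (c + η) with h | h <;> simp only [hm, h, if_true, not_false_eq_true, if_false] <;>
      split_ifs <;> linarith

section Code

variable {n k : ℕ} {A : Matrix (Fin k) (Fin n) (ZMod 2)} {p : ℝ}
  {decC : (Fin n → ZMod 2) → (Fin k → ZMod 2)}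

theorem prob_decC_ne_le_pFail (v : Fin k → ZMod 2) :
    prob (berMass p) (fun η : Fin n → ZMod 2 => decC (encC A v + η) ≠ v) ≤ pFail p A decC :=
  le_ciSup (f := fun v => prob (berMass p) fun η : Fin n → ZMod 2 => decC (encC A v + η) ≠ v)
    (Set.finite_range _).bddAbove v

theorem pFail_nonneg (h0 : 0 ≤ p) (h1 : p ≤ 1) : 0 ≤ pFail p A decC :=
  (prob_nonneg (berMass_nonneg h0 h1) _).trans (prob_decC_ne_le_pFail 0)

/-- Two codewords at minimum distance, written through the generator matrix. -/
theorem exists_hammingDist_encC_eq_minDist {C : Submodule (ZMod 2) (Fin n → ZMod 2)}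
    (hk : 0 < k) (hA : IsGeneratorMatrix C A) :
    0 < minDist C ∧ ∃ v v', v ≠ v' ∧ hammingDist (encC A v) (encC A v') = minDist C := by
  have hrow : ∀ i, A.row i ∈ C := fun i => hA.2 ▸ Submodule.subset_span ⟨i, rfl⟩
  have hne : {m | ∃ c ∈ C, ∃ c' ∈ C, c ≠ c' ∧ hammingDist c c' = m}.Nonempty :=
    ⟨_, A.row ⟨0, hk⟩, hrow _, 0, C.zero_mem, hA.1.ne_zero _, rfl⟩
  obtain ⟨c, hc, c', hc', hcc, hdist⟩ := Nat.sInf_mem hne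
  have hsurj : ∀ c ∈ C, ∃ v, encC A v = c := fun c hc => by
    rw [← hA.2, ← range_vecMulLinear] at hc
    exact hc
  obtain ⟨v, rfl⟩ := hsurj c hc
  obtain ⟨v', rfl⟩ := hsurj c' hc'
  refine ⟨?_, v, v', fun h => hcc (by rw [h]), hdist⟩
  rw [minDist, ← hdist]
  exact hammingDist_pos.2 hcc

/-- The majority vote on a noisy repetition block of the length of the minimum distance, with
ties decided by a fair coin, errs with probability at most `P_fail`. -/
theorem prob_maj_ne_le_pFail (h0 : 0 < p) (h1 : p ≤ 1 / 2) {d D : ℕ}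
    (hD : ∃ v v', v ≠ v' ∧ hammingDist (encC A v) (encC A v') = D)
    {e : Fin D → Fin d} (he : Function.Injective e) (b : ZMod 2) (l : Fin 3) :
    prob (fun ω : (Fin d → ZMod 2) × (Fin 3 → ZMod 2) =>
        berMass p ω.1 * berMass (1 / 2) ω.2)
      (fun ω => maj (ω.2 l) (fun s => b + ω.1 (e s)) ≠ b) ≤ pFail p A decC := by
  obtain ⟨v, v', hv, hdist⟩ := hD
  set q : ZMod 2 → ℝ := fun c => prob (berMass p) fun η : Fin D → ZMod 2 => maj c η = 1 with hq
  have hqq : ∀ c, q c + q (c + 1) ≤ 2 * pFail p A decC := fun c => by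
    refine (prob_maj_add_prob_maj_le h0 h1 _ _ hdist (fun y => decC y ≠ v)
      (fun y => decC y ≠ v') (fun y => ?_) c).trans ?_
    · by_contra! h
      exact hv (h.1.symm.trans h.2)
    · rw [two_mul]
      exact add_le_add (prob_decC_ne_le_pFail v) (prob_decC_ne_le_pFail v')
  rw [prob_prod]
  have hinner : ∀ c : Fin 3 → ZMod 2,
      prob (berMass p) (fun η : Fin d → ZMod 2 => maj (c l) (fun s => b + η (e s)) ≠ b) =
        q (c l + b) := fun c => by
    rw [hq]
    beta_reduce
    rw [← prob_berMass_comp he fun η : Fin D → ZMod 2 => maj (c l + b) η = 1]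
    congr 1
    ext η
    exact maj_shift_ne_iff (c l) b (η ∘ e)
  simp only [hinner]
  have hhalf : ∀ c : Fin 3 → ZMod 2, berMass (1 / 2) (c + 1) = berMass (1 / 2) c := fun c =>
    Finset.prod_congr rfl fun i _ => by split_ifs <;> norm_num
  -- flipping all the coins preserves their law
  have hflip : ∑ c : Fin 3 → ZMod 2, berMass (1 / 2) c * q (c l + b) =
      ∑ c : Fin 3 → ZMod 2, berMass (1 / 2) c * q (c l + b + 1) := by
    rw [← Equiv.sum_comp (Equiv.addRight (1 : Fin 3 → ZMod 2))]
    refine Finset.sum_congr rfl fun c _ => ?_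
    change berMass (1 / 2) (c + 1) * q (c l + 1 + b) = _
    rw [hhalf, add_right_comm]
  have hsum : ∑ c : Fin 3 → ZMod 2, berMass (1 / 2) c * (q (c l + b) + q (c l + b + 1)) ≤
      ∑ c : Fin 3 → ZMod 2, berMass (1 / 2) c * (2 * pFail p A decC) :=
    Finset.sum_le_sum fun c _ =>
      mul_le_mul_of_nonneg_left (hqq _) (berMass_nonneg (by norm_num) (by norm_num) _)
  rw [← Finset.sum_mul, sum_berMass, one_mul] at hsum
  simp only [mul_add, Finset.sum_add_distrib] at hsum
  linarith

end Code

/-! ### The binary reflected code -/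

/-- The bit of `R_k(i)` with `z` bits after it is the parity of `⌊(i + 2^z) / 2^(z+1)⌋`. -/
theorem brc_apply (k i : ℕ) (hi : i < 2 ^ k) (z : Fin k) :
    brc k i z = (((i + 2 ^ (z.rev : ℕ)) / 2 ^ ((z.rev : ℕ) + 1) : ℕ) : ZMod 2) := by
  induction k generalizing i with
  | zero => exact z.elim0
  | succ k ih =>
    have h2k : 2 ^ (k + 1) = 2 * 2 ^ k := by ring
    refine Fin.cases ?_ (fun z => ?_) z
    · have hz : ((0 : Fin (k + 1)).rev : ℕ) = k := by simp
      rw [hz, brc]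
      split_ifs with h
      · rw [Fin.cons_zero, Nat.div_eq_of_lt (by omega), Nat.cast_zero]
      · rw [Fin.cons_zero, show (i + 2 ^ k) / 2 ^ (k + 1) = 1 from
          Nat.div_eq_of_lt_le (by omega) (by omega), Nat.cast_one]
    · have hz : (z.succ.rev : ℕ) = z.rev := by simp [Fin.val_rev]
      rw [hz, brc]
      split_ifs with h
      · rw [Fin.cons_succ, ih i h]
      · rw [Fin.cons_succ, ih _ (by omega), ZMod.natCast_eq_natCast_iff']
        have hzk : (z.rev : ℕ) < k := z.rev.isLt
        set y := (z.rev : ℕ)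
        -- the reflection sends the quotient to its difference from the even number `2 * Q`
        obtain ⟨Q, hQ⟩ : ∃ Q, 2 ^ (k + 1) = 2 ^ (y + 1) * (2 * Q) := by
          refine ⟨2 ^ (k - 1 - y), ?_⟩
          rw [← pow_succ', ← pow_add]
          congr 1
          omega
        have hM : 2 ^ (y + 1) = 2 * 2 ^ y := by ring
        have hMpos : 0 < 2 ^ y := by positivity
        set H := 2 ^ y
        rw [hM] at hQ ⊢
        set a := (i + H) / (2 * H) with ha
        have h1 : 2 * H * a ≤ i + H := Nat.mul_div_le _ _
        have h2 : i + H < 2 * H * (a + 1) := Nat.lt_mul_div_succ _ (by omega)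
        have haQ : a ≤ 2 * Q := by
          by_contra hlt
          have : 2 * H * (2 * Q + 1) ≤ 2 * H * a := Nat.mul_le_mul_left _ (by omega)
          have : 2 * H * (2 * Q + 1) = 2 * H * (2 * Q) + 2 * H := by ring
          omega
        have hdiv : (2 ^ (k + 1) - 1 - i + H) / (2 * H) = 2 * Q - a := by
          obtain ⟨r, hr⟩ := Nat.exists_eq_add_of_le haQ
          rw [hr, Nat.add_sub_cancel_left]
          have e1 : 2 * H * (2 * Q) = 2 * H * a + 2 * H * r := by rw [hr]; ring
          have e2 : 2 * H * (a + 1) = 2 * H * a + 2 * H := by ring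
          refine Nat.div_eq_of_lt_le ?_ ?_
          · rw [mul_comm]
            omega
          · rw [mul_comm, mul_add]
            omega
        rw [hdiv]
        omega

theorem brc_injOn (k : ℕ) : Set.InjOn (brc k) (Set.Iio (2 ^ k)) := by
  induction k with
  | zero =>
    intro a ha b hb _
    simp only [pow_zero, Set.mem_Iio, Nat.lt_one_iff] at ha hb
    rw [ha, hb]
  | succ k ih =>
    intro a ha b hb hab
    simp only [Set.mem_Iio] at ha hb
    have h2k : 2 ^ (k + 1) = 2 * 2 ^ k := by ring
    rw [brc, brc] at hab
    split_ifs at hab with h1 h2 h2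
    · exact ih h1 h2 (Fin.cons_injective2 hab).2
    · exact absurd (Fin.cons_injective2 hab).1 (by decide)
    · exact absurd (Fin.cons_injective2 hab).1 (by decide)
    · have := ih (x₁ := 2 ^ (k + 1) - 1 - a) (x₂ := 2 ^ (k + 1) - 1 - b)
        (by simp only [Set.mem_Iio]; omega) (by simp only [Set.mem_Iio]; omega)
        (Fin.cons_injective2 hab).2
      omega

theorem brcInv_brc {k i : ℕ} (hi : i < 2 ^ k) : brcInv k (brc k i) = i :=
  (brc_injOn k).leftInvOn_invFunOn hi

/-- On the way from `i` to `i + 1` exactly one of the quotients `⌊(i + 2^y) / 2^(y+1)⌋` grows: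
the one for which `y` is the multiplicity of `2` in `i + 1`. -/
theorem exists_flip {k i : ℕ} (hi : i + 1 < 2 ^ k) :
    ∃ z : Fin k, ∀ z' : Fin k,
      (i + 1 + 2 ^ (z'.rev : ℕ)) / 2 ^ ((z'.rev : ℕ) + 1) =
        (i + 2 ^ (z'.rev : ℕ)) / 2 ^ ((z'.rev : ℕ) + 1) + if z' = z then 1 else 0 := by
  obtain ⟨y, m, hm⟩ := Nat.exists_eq_two_pow_mul_odd (n := i + 1) (by omega)
  obtain ⟨⟨a, rfl⟩, hm⟩ := hm
  have hy : y < k := by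
    refine (Nat.pow_lt_pow_iff_right (a := 2) (by norm_num)).1 (lt_of_le_of_lt ?_ hi)
    rw [hm]
    exact Nat.le_mul_of_pos_right _ (by omega)
  have hdvd : ∀ x, 2 ^ (x + 1) ∣ i + 1 + 2 ^ x ↔ x = y := by
    intro x
    rw [hm]
    constructor
    · rintro ⟨c, hc⟩
      rcases lt_trichotomy x y with h | h | h
      · obtain ⟨r, rfl⟩ := Nat.exists_eq_add_of_lt h
        have : 2 ^ x * (2 * (2 ^ r * (2 * a + 1)) + 1) = 2 ^ x * (2 * c) := by
          calc _ = 2 ^ (x + r + 1) * (2 * a + 1) + 2 ^ x := by ring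
            _ = _ := by rw [hc]; ring
        have := Nat.eq_of_mul_eq_mul_left (by positivity) this
        omega
      · exact h
      · obtain ⟨r, rfl⟩ := Nat.exists_eq_add_of_lt h
        have : 2 ^ y * (2 * a + 1 + 2 * 2 ^ r) = 2 ^ y * (2 * (2 ^ r * 2 * c)) := by
          calc _ = 2 ^ y * (2 * a + 1) + 2 ^ (y + r + 1) := by ring
            _ = _ := by rw [hc]; ring
        have := Nat.eq_of_mul_eq_mul_left (by positivity) this
        omega
    · rintro rfl
      exact ⟨a + 1, by ring⟩
  refine ⟨(⟨y, hy⟩ : Fin k).rev, fun z' => ?_⟩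
  rw [show i + 1 + 2 ^ (z'.rev : ℕ) = (i + 2 ^ (z'.rev : ℕ)) + 1 by ring, Nat.succ_div]
  congr 1
  rw [show (i + 2 ^ (z'.rev : ℕ)) + 1 = i + 1 + 2 ^ (z'.rev : ℕ) by ring]
  refine if_congr ((hdvd _).trans ?_) rfl rfl
  rw [← Fin.rev_eq_iff, Fin.ext_iff]

theorem brc_succ_eq_add_single {k i : ℕ} (hi : i + 1 < 2 ^ k) {z : Fin k}
    (hz : ∀ z' : Fin k,
      (i + 1 + 2 ^ (z'.rev : ℕ)) / 2 ^ ((z'.rev : ℕ) + 1) =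
        (i + 2 ^ (z'.rev : ℕ)) / 2 ^ ((z'.rev : ℕ) + 1) + if z' = z then 1 else 0) :
    brc k (i + 1) = brc k i + Pi.single z 1 := by
  funext z'
  rw [brc_apply _ _ hi, Pi.add_apply, brc_apply k i (by omega), hz z', Pi.single_apply]
  split_ifs <;> simp

section Code

variable {n k : ℕ} (D : ℕ) (A : Matrix (Fin k) (Fin n) (ZMod 2))

theorem brc_zero (k : ℕ) : brc k 0 = 0 := by
  funext z
  rw [brc_apply k 0 (by positivity), Nat.div_eq_of_lt]
  · simp
  · rw [zero_add]
    exact Nat.pow_lt_pow_right (by norm_num) (by omega)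

theorem cSeq_eq_encC {i : ℕ} (hi : i < 2 ^ k) : cSeq A i = encC A (brc k i) := by
  induction i with
  | zero => rw [cSeq, brc_zero, encC, Matrix.zero_vecMul]
  | succ i ih =>
    obtain ⟨z, hz⟩ := exists_flip hi
    have hstep := brc_succ_eq_add_single hi hz
    have hne : ∀ z', brc k i z' ≠ brc k (i + 1) z' ↔ z' = z := fun z' => by
      rw [hstep, Pi.add_apply, Pi.single_apply]
      split_ifs with h <;> simp [h]
    have hex : ∃ z', brc k i z' ≠ brc k (i + 1) z' := ⟨z, (hne z).2 rfl⟩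
    rw [cSeq, dif_pos hex, ih (by omega), (hne _).1 hex.choose_spec]
    rw [hstep, encC, encC, Matrix.add_vecMul, Matrix.single_one_vecMul]

/-- The row added between `c_i` and `c_{i+1}` is the one whose quotient grows in `ρ`. -/
theorem computeR_succ {i : ℕ} (hi : i + 1 < 2 ^ k) :
    computeR D A (i + 1) =
      computeR D A i + (3 * D + 2 * hammingDist (cSeq A i) (cSeq A (i + 1))) := by
  obtain ⟨z, hz⟩ := exists_flip hi
  have hstep := brc_succ_eq_add_single hi hz
  have hdist : hammingDist (cSeq A i) (cSeq A (i + 1)) = hammingNorm (A.row z) := by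
    rw [cSeq_eq_encC A hi, cSeq_eq_encC A (by omega), hstep, encC, encC, Matrix.add_vecMul,
      Matrix.single_one_vecMul, hammingDist_eq_hammingNorm, neg_add_cancel_left]
  have hsum : ∀ m, computeR D A m = (∑ z' : Fin k,
      2 * ((m + 2 ^ (z'.rev : ℕ)) / 2 ^ ((z'.rev : ℕ) + 1)) * hammingNorm (A.row z')) +
        3 * D * m := fun m => by
    rw [computeR, ← Equiv.sum_comp Fin.revPerm]
    simp
  rw [hsum, hsum, hdist]
  simp only [hz, mul_add, add_mul, Finset.sum_add_distrib]
  simp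
  ring

end Code

/-! ### Cutting one word over into another -/

section Cut

variable {d : ℕ}

/-- The word that agrees with `w'` on the first `q` positions and with `w` on the others. -/
def cut (w w' : Fin d → ZMod 2) (q : ℕ) : Fin d → ZMod 2 :=
  fun t => if (t : ℕ) < q then w' t else w t

/-- The number of differences between `w` and `w'` among the first `q` positions. -/
def cutCount (w w' : Fin d → ZMod 2) (q : ℕ) : ℕ :=
  (Finset.univ.filter fun t : Fin d => (t : ℕ) < q ∧ w t ≠ w' t).card

variable (w w' : Fin d → ZMod 2)

theorem cut_zero : cut w w' 0 = w := by
  funext t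
  simp [cut]

theorem cut_of_le {q : ℕ} (hq : d ≤ q) : cut w w' q = w' := by
  funext t
  simp [cut, t.isLt.trans_le hq]

theorem cutCount_zero : cutCount w w' 0 = 0 := by
  simp [cutCount]

theorem cutCount_of_le {q : ℕ} (hq : d ≤ q) : cutCount w w' q = hammingDist w w' := by
  unfold cutCount hammingDist
  congr 1
  ext t
  simp [t.isLt.trans_le hq]

theorem cutCount_mono : Monotone (cutCount w w') := fun q q' h =>
  Finset.card_le_card fun t ht => by
    simp only [Finset.mem_filter, Finset.mem_univ, true_and] at ht ⊢
    exact ⟨ht.1.trans_le h, ht.2⟩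

theorem cutCount_add_card {q q' : ℕ} (h : q ≤ q') :
    cutCount w w' q' = cutCount w w' q +
      (Finset.univ.filter fun t : Fin d => q ≤ (t : ℕ) ∧ (t : ℕ) < q' ∧ w t ≠ w' t).card := by
  unfold cutCount
  rw [← Finset.card_union_of_disjoint]
  · congr 1
    ext t
    simp only [Finset.mem_filter, Finset.mem_univ, true_and, Finset.mem_union]
    constructor
    · rintro ⟨h1, h2⟩
      rcases lt_or_ge (t : ℕ) q with h3 | h3
      · exact Or.inl ⟨h3, h2⟩
      · exact Or.inr ⟨h3, h1, h2⟩
    · rintro (⟨h1, h2⟩ | ⟨_, h1, h2⟩)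
      · exact ⟨h1.trans_le h, h2⟩
      · exact ⟨h1, h2⟩
  · rw [Finset.disjoint_filter]
    rintro t - ⟨h1, _⟩ ⟨h2, _⟩
    omega

theorem hammingDist_cut_cut {q q' : ℕ} (h : q ≤ q') :
    cutCount w w' q' = cutCount w w' q + hammingDist (cut w w' q) (cut w w' q') := by
  rw [cutCount_add_card w w' h, hammingDist]
  congr 2
  ext t
  rw [Finset.mem_filter, Finset.mem_filter]
  simp only [Finset.mem_univ, true_and, cut]
  split_ifs with h1 h2 h2 <;> grind

theorem hammingDist_cut_cut_natAbs (q q' : ℕ) :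
    hammingDist (cut w w' q) (cut w w' q') =
      ((cutCount w w' q : ℤ) - cutCount w w' q').natAbs := by
  rcases le_total q q' with h | h
  · have := hammingDist_cut_cut w w' h
    omega
  · have := hammingDist_cut_cut w w' h
    rw [hammingDist_comm]
    omega

theorem cut_eq_cut_of_cutCount_eq {q q' : ℕ} (h : cutCount w w' q = cutCount w w' q') :
    cut w w' q = cut w w' q' := by
  rw [← hammingDist_eq_zero, hammingDist_cut_cut_natAbs, h, sub_self, Int.natAbs_zero]

theorem cutCount_succ_le (q : ℕ) : cutCount w w' (q + 1) ≤ cutCount w w' q + 1 := by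
  rw [cutCount_add_card w w' (Nat.le_succ q)]
  refine Nat.add_le_add_left (Finset.card_le_one.2 fun a ha b hb => ?_) _
  simp only [Finset.mem_filter, Finset.mem_univ, true_and] at ha hb
  exact Fin.ext (by omega)

theorem exists_cutCount_eq {m : ℕ} (q : ℕ) (hm : m ≤ cutCount w w' q) :
    ∃ q' ≤ q, cutCount w w' q' = m := by
  induction q with
  | zero => exact ⟨0, le_rfl, by rw [cutCount_zero] at hm ⊢; omega⟩
  | succ q ih =>
    have := cutCount_succ_le w w' q
    rcases Nat.lt_or_ge (cutCount w w' q) m with h | h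
    · exact ⟨q + 1, le_rfl, by omega⟩
    · obtain ⟨q', h1, h2⟩ := ih h
      exact ⟨q', h1.trans (Nat.le_succ q), h2⟩

/-- The differences before the end of a chunk are those before the chunk and those within it. -/
theorem cutCount_add_hammingDist_sub {a l : ℕ} (h : a + l ≤ d) :
    cutCount w w' (a + l) = cutCount w w' a + hammingDist (sub a l h w) (sub a l h w') := by
  rw [cutCount_add_card w w' (Nat.le_add_right a l), hammingDist]
  congr 1
  symm
  refine Finset.card_bij (fun s _ => ⟨a + s, by omega⟩) ?_ ?_ ?_
  · intro s hs
    simp only [Finset.mem_filter, Finset.mem_univ, true_and] at hs ⊢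
    exact ⟨by omega, by omega, hs⟩
  · intro s _ s' _ hss
    simpa [Fin.ext_iff] using hss
  · intro t ht
    simp only [Finset.mem_filter, Finset.mem_univ, true_and] at ht
    obtain ⟨s, hs⟩ := Nat.exists_eq_add_of_le ht.1
    have hst : (⟨a + s, by omega⟩ : Fin d) = t := Fin.ext hs.symm
    refine ⟨⟨s, by omega⟩, ?_, hst⟩
    rw [Finset.mem_filter]
    simp only [Finset.mem_univ, true_and, sub, hst]
    exact ht.2.2

theorem sub_cut_of_le {a l q : ℕ} (h : a + l ≤ d) (hq : a + l ≤ q) :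
    sub a l h (cut w w' q) = sub a l h w' := by
  funext s
  simp only [sub, cut]
  rw [if_pos (by omega)]

theorem sub_cut_of_ge {a l q : ℕ} (h : a + l ≤ d) (hq : q ≤ a) :
    sub a l h (cut w w' q) = sub a l h w := by
  funext s
  simp only [sub, cut]
  rw [if_neg (by omega)]

/-! ### Unary decoding of a cut -/

theorem decU_spec {l : ℕ} (y : Fin l → ZMod 2) :
    decU y ≤ l ∧ ∀ v ≤ l, hammingDist y (encU l (decU y)) ≤ hammingDist y (encU l v) := by
  have hne : {v | v ≤ l ∧ ∀ v' ≤ l,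
      hammingDist y (encU l v) ≤ hammingDist y (encU l v')}.Nonempty := by
    obtain ⟨v, hv, hmin⟩ := Finset.exists_min_image (Finset.range (l + 1))
      (fun v => hammingDist y (encU l v)) ⟨0, by simp⟩
    exact ⟨v, by simpa [Nat.lt_succ_iff] using hv, fun v' hv' => hmin v' (by simp; omega)⟩
  exact Nat.sInf_mem hne

variable {w w'}

/-- If `e` enumerates the differences in `[lo, hi)`, then a cut at `q ∈ [lo, hi]` has passed
exactly the first `v` of them, for some `v`. -/
theorem exists_cutCount_eq_add {lo hi l : ℕ} {e : Fin l → Fin d} (he : StrictMono e)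
    (hrange : ∀ t, (∃ s, e s = t) ↔ lo ≤ (t : ℕ) ∧ (t : ℕ) < hi ∧ w t ≠ w' t)
    {q : ℕ} (hlo : lo ≤ q) (hhi : q ≤ hi) :
    ∃ v ≤ l, cutCount w w' q = cutCount w w' lo + v ∧
      ∀ s : Fin l, (e s : ℕ) < q ↔ (s : ℕ) < v := by
  set S := Finset.univ.filter fun s : Fin l => (e s : ℕ) < q with hS
  have hmem : ∀ s, s ∈ S ↔ (e s : ℕ) < q := fun s => by simp [hS]
  refine ⟨S.card, by simpa using S.card_le_univ, ?_, fun s => ?_⟩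
  · rw [cutCount_add_card w w' hlo, ← Finset.card_image_of_injective S he.injective]
    congr 2
    ext t
    simp only [Finset.mem_filter, Finset.mem_univ, true_and, Finset.mem_image, hmem]
    constructor
    · rintro ⟨h1, h2, h3⟩
      obtain ⟨s, rfl⟩ := (hrange t).2 ⟨h1, h2.trans_le hhi, h3⟩
      exact ⟨s, h2, rfl⟩
    · rintro ⟨s, h1, rfl⟩
      have := (hrange (e s)).1 ⟨s, rfl⟩
      exact ⟨this.1, h1, this.2.2⟩
  · rw [← hmem]
    constructor
    · intro h
      have hsub : Finset.Iic s ⊆ S := fun s' hs' => by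
        rw [hmem] at h ⊢
        exact lt_of_le_of_lt (he.monotone (Finset.mem_Iic.1 hs')) h
      have := Finset.card_le_card hsub
      rw [Fin.card_Iic] at this
      omega
    · intro h
      by_contra hs
      have hsub : S ⊆ Finset.Iio s := fun s' hs' => by
        rw [hmem] at hs hs'
        rw [Finset.mem_Iio]
        by_contra hle
        exact hs (lt_of_le_of_lt (he.monotone (not_lt.1 hle)) hs')
      have := Finset.card_le_card hsub
      rw [Fin.card_Iio] at this
      omega

/-- On the positions `e` at which `w` and `w'` differ between `lo` and `hi`, the cuts of `w` into
`w'` form a unary code, and elsewhere all cuts at `q ∈ [lo, hi]` agree. So the unary decoder finds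
a closest one among these cuts. -/
theorem exists_cut_eq_decU {lo hi l : ℕ} (hlh : lo ≤ hi) {e : Fin l → Fin d} (he : StrictMono e)
    (hrange : ∀ t, (∃ s, e s = t) ↔ lo ≤ (t : ℕ) ∧ (t : ℕ) < hi ∧ w t ≠ w' t)
    (x : Fin d → ZMod 2) :
    ∃ q, lo ≤ q ∧ q ≤ hi ∧
      cutCount w w' q = cutCount w w' lo + decU (fun s => x (e s) + w (e s)) ∧
      ∀ q', lo ≤ q' → q' ≤ hi → hammingDist x (cut w w' q) ≤ hammingDist x (cut w w' q') := by
  have h1 : ∀ a b b' : ZMod 2, b ≠ b' → (a ≠ b' ↔ a + b ≠ 1) := by decide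
  have h2 : ∀ a b : ZMod 2, a ≠ b ↔ a + b ≠ 0 := by decide
  set y : Fin l → ZMod 2 := fun s => x (e s) + w (e s) with hy
  set K := (Finset.univ.filter fun t : Fin d =>
    (¬ ∃ s, e s = t) ∧ x t ≠ cut w w' lo t).card with hK
  have hdist : ∀ q, lo ≤ q → q ≤ hi → ∀ v, (∀ s : Fin l, (e s : ℕ) < q ↔ (s : ℕ) < v) →
      hammingDist x (cut w w' q) = hammingDist y (encU l v) + K := by
    intro q hq hq' v hv
    rw [hK, hammingDist, hammingDist, ← Finset.card_image_of_injective _ he.injective,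
      ← Finset.card_union_of_disjoint]
    · congr 1
      ext t
      simp only [Finset.mem_filter, Finset.mem_univ, true_and, Finset.mem_union,
        Finset.mem_image]
      by_cases ht : ∃ s, e s = t
      · have hin := (hrange t).1 ht
        obtain ⟨s, rfl⟩ := ht
        have hs : x (e s) ≠ cut w w' q (e s) ↔ y s ≠ encU l v s := by
          simp only [cut, encU, hv, hy]
          split_ifs
          · exact h1 _ _ _ hin.2.2
          · exact h2 _ _
        rw [hs]
        constructor
        · exact fun h => Or.inl ⟨s, h, rfl⟩
        · rintro (⟨s', h, hss⟩ | ⟨h, _⟩)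
          · rwa [← he.injective hss]
          · exact absurd ⟨s, rfl⟩ h
      · have hcut : cut w w' q t = cut w w' lo t := by
          have hnot := fun h => ht ((hrange t).2 h)
          unfold cut
          by_cases ha : (t : ℕ) < lo
          · rw [if_pos ha, if_pos (by omega)]
          · by_cases hb : (t : ℕ) < q
            · rw [if_pos hb, if_neg ha]
              by_contra hne
              exact hnot ⟨by omega, by omega, fun h => hne h.symm⟩
            · rw [if_neg ha, if_neg hb]
        rw [hcut]
        constructor
        · exact fun h => Or.inr ⟨ht, h⟩
        · rintro (⟨s', _, hss⟩ | ⟨_, h⟩)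
          · exact absurd ⟨s', hss⟩ ht
          · exact h
    · rw [Finset.disjoint_left]
      rintro t ht
      obtain ⟨s, _, rfl⟩ := Finset.mem_image.1 ht
      simp
  obtain ⟨hu, hmin⟩ := decU_spec y
  obtain ⟨l', hl', hcount, hall⟩ := exists_cutCount_eq_add he hrange hlh le_rfl
  have hll : l' = l := by
    by_contra hne
    have := (hall ⟨l', by omega⟩).1 ((hrange _).1 ⟨_, rfl⟩).2.1
    simp at this
  obtain ⟨q₀, hq₀, hcount₀⟩ := exists_cutCount_eq w w' (m := cutCount w w' lo + decU y) hi
    (by omega)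
  -- the witness may be too small when no difference precedes it
  have hq₁ : cutCount w w' (max lo q₀) = cutCount w w' lo + decU y := by
    rcases le_total lo q₀ with h | h
    · rw [max_eq_right h, hcount₀]
    · have := cutCount_mono w w' h
      rw [max_eq_left h]
      omega
  refine ⟨max lo q₀, le_max_left _ _, max_le hlh hq₀, hq₁, fun q' hlo' hhi' => ?_⟩
  obtain ⟨v, _, hv, hv'⟩ := exists_cutCount_eq_add he hrange (le_max_left lo q₀) (max_le hlh hq₀)
  obtain ⟨v₁, hv₁, _, hv₁'⟩ := exists_cutCount_eq_add he hrange hlo' hhi'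
  have hvu : v = decU y := by omega
  rw [hdist _ (le_max_left _ _) (max_le hlh hq₀) v hv', hdist _ hlo' hhi' v₁ hv₁', hvu]
  exact Nat.add_le_add_right (hmin v₁ hv₁) K

end Cut

theorem mem_dropLast_iff_of_pairwise_lt {β : Type*} [LinearOrder β] {L : List β}
    (hL : L.Pairwise (· < ·)) {a : β} (ha : a ∈ L) (hmax : ∀ t ∈ L, t ≤ a) (t : β) :
    t ∈ L.dropLast ↔ t ∈ L ∧ t < a := by
  have hne : L ≠ [] := List.ne_nil_of_mem ha
  obtain ⟨M, c, rfl⟩ : ∃ M c, L = M ++ [c] :=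
    ⟨L.dropLast, L.getLast hne, (List.dropLast_append_getLast hne).symm⟩
  rw [List.dropLast_concat]
  rw [List.pairwise_append] at hL
  have hlt : ∀ s ∈ M, s < c := fun s hs => hL.2.2 s hs c (by simp)
  have hca : c = a := by
    refine le_antisymm (hmax c (by simp)) ?_
    rcases List.mem_append.1 ha with h | h
    · exact (hlt a h).le
    · exact le_of_eq (List.mem_singleton.1 h)
  subst hca
  constructor
  · exact fun h => ⟨List.mem_append_left _ h, hlt t h⟩
  · rintro ⟨h1, h2⟩
    rcases List.mem_append.1 h1 with h | h
    · exact h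
    · exact absurd (List.mem_singleton.1 h) h2.ne

/-! ### The Gray code as a sequence of cuts -/

section Gray

variable {n k : ℕ} (D : ℕ) (A : Matrix (Fin k) (Fin n) (ZMod 2))

theorem s1_wSeq (i : ℕ) : s1 (wSeq D A i) = fun _ => (i : ZMod 2) := by
  funext s
  simp only [s1, sub, wSeq, wordW]
  rw [dif_pos (by omega)]

theorem c1_wSeq (i : ℕ) : c1 (wSeq D A i) = cSeq A i := by
  funext s
  simp only [c1, sub, wSeq, wordW]
  rw [dif_neg (by omega), dif_pos (by omega)]
  congr 1
  exact Fin.ext (by simp)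

theorem s2_wSeq (i : ℕ) : s2 (wSeq D A i) = fun _ => (i : ZMod 2) := by
  funext s
  simp only [s2, sub, wSeq, wordW]
  rw [dif_neg (by omega), dif_neg (by omega), dif_pos (by omega)]

theorem c2_wSeq (i : ℕ) : c2 (wSeq D A i) = cSeq A i := by
  funext s
  simp only [c2, sub, wSeq, wordW]
  rw [dif_neg (by omega), dif_neg (by omega), dif_neg (by omega), dif_pos (by omega)]
  congr 1
  exact Fin.ext (by simp)

theorem s3_wSeq (i : ℕ) : s3 (wSeq D A i) = fun _ => (i : ZMod 2) := by
  funext s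
  simp only [s3, sub, wSeq, wordW]
  rw [dif_neg (by omega), dif_neg (by omega), dif_neg (by omega), dif_neg (by omega)]

theorem natCast_ne_succ (i : ℕ) : (i : ZMod 2) ≠ ((i + 1 : ℕ) : ZMod 2) := by
  rw [Nat.cast_succ]
  exact (by decide : ∀ b : ZMod 2, b ≠ b + 1) i

theorem hammingDist_const_natCast_succ (i : ℕ) :
    hammingDist (fun _ : Fin D => (i : ZMod 2)) (fun _ => ((i + 1 : ℕ) : ZMod 2)) = D := by
  rw [hammingDist, Finset.filter_true_of_mem fun _ _ => natCast_ne_succ i, Finset.card_fin]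

/-- The number of differences between `w_i` and `w_{i+1}` before position `q`. -/
noncomputable def blockCount (i q : ℕ) : ℕ :=
  cutCount (wSeq D A i) (wSeq D A (i + 1)) q

/-- The word in the block of `w_i` and `w_{i+1}` whose crossover is at position `q`. -/
noncomputable def blockCut (i q : ℕ) : Fin (2 * n + 3 * D) → ZMod 2 :=
  cut (wSeq D A i) (wSeq D A (i + 1)) q

theorem blockCount_s1 (i : ℕ) : blockCount D A i D = D := by
  have h : blockCount D A i (0 + D) = blockCount D A i 0 +
      hammingDist (s1 (wSeq D A i)) (s1 (wSeq D A (i + 1))) :=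
    cutCount_add_hammingDist_sub _ _ (by omega)
  have h0 : blockCount D A i 0 = 0 := cutCount_zero _ _
  rwa [s1_wSeq, s1_wSeq, hammingDist_const_natCast_succ, h0, zero_add] at h

theorem blockCount_c1 (i : ℕ) :
    blockCount D A i (D + n) = D + hammingDist (cSeq A i) (cSeq A (i + 1)) := by
  refine (cutCount_add_hammingDist_sub _ _ (a := D) (l := n) (by omega)).trans ?_
  rw [← c1_wSeq D A i, ← c1_wSeq D A (i + 1)]
  exact congrArg (· + _) (blockCount_s1 D A i)

theorem blockCount_s2 (i : ℕ) :
    blockCount D A i (2 * D + n) = 2 * D + hammingDist (cSeq A i) (cSeq A (i + 1)) := by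
  have h : blockCount D A i (D + n + D) = blockCount D A i (D + n) +
      hammingDist (s2 (wSeq D A i)) (s2 (wSeq D A (i + 1))) :=
    cutCount_add_hammingDist_sub _ _ (by omega)
  rw [s2_wSeq, s2_wSeq, hammingDist_const_natCast_succ, blockCount_c1] at h
  rw [show 2 * D + n = D + n + D by ring, h]
  ring

theorem blockCount_c2 (i : ℕ) :
    blockCount D A i (2 * D + 2 * n) = 2 * D + 2 * hammingDist (cSeq A i) (cSeq A (i + 1)) := by
  have h : blockCount D A i (2 * D + n + n) = blockCount D A i (2 * D + n) +
      hammingDist (c2 (wSeq D A i)) (c2 (wSeq D A (i + 1))) :=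
    cutCount_add_hammingDist_sub _ _ (by omega)
  rw [c2_wSeq, c2_wSeq, blockCount_s2] at h
  rw [show 2 * D + 2 * n = 2 * D + n + n by ring, h]
  ring

theorem hammingDist_wSeq_succ (i : ℕ) :
    hammingDist (wSeq D A i) (wSeq D A (i + 1)) =
      3 * D + 2 * hammingDist (cSeq A i) (cSeq A (i + 1)) := by
  have h : blockCount D A i (2 * D + 2 * n + D) = blockCount D A i (2 * D + 2 * n) +
      hammingDist (s3 (wSeq D A i)) (s3 (wSeq D A (i + 1))) :=
    cutCount_add_hammingDist_sub _ _ (by omega)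
  rw [s3_wSeq, s3_wSeq, hammingDist_const_natCast_succ, blockCount_c2] at h
  rw [← cutCount_of_le _ _ (q := 2 * D + 2 * n + D) (by omega)]
  exact h.trans (by ring)

theorem computeR_eq_rSeq {i : ℕ} (hi : i < 2 ^ k) : computeR D A i = rSeq D A i := by
  induction i with
  | zero =>
    have h : ∀ z : Fin k, 2 ^ (z : ℕ) / 2 ^ ((z : ℕ) + 1) = 0 := fun z =>
      Nat.div_eq_of_lt (Nat.pow_lt_pow_right (by norm_num) (by omega))
    simp [computeR, rSeq, h]
  | succ i ih =>
    rw [computeR_succ D A hi, ih (by omega), rSeq, rSeq, Finset.sum_range_succ,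
      hammingDist_wSeq_succ]

theorem rSeq_succ (i : ℕ) :
    rSeq D A (i + 1) = rSeq D A i + hammingDist (wSeq D A i) (wSeq D A (i + 1)) :=
  Finset.sum_range_succ _ _

variable {D}

theorem rSeq_strictMono (hD : 0 < D) : StrictMono (rSeq D A) :=
  strictMono_nat_of_lt_succ fun i => by
    rw [rSeq_succ, hammingDist_wSeq_succ]
    omega

theorem blockG_eq (hD : 0 < D) {i j : ℕ} (hi : i ≤ 2 ^ k - 1) (hij : rSeq D A i ≤ j)
    (hj : j < rSeq D A (i + 1)) : blockG D A j = i := by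
  refine Nat.findGreatest_eq_iff.2 ⟨hi, fun _ => hij, fun i' hlt _ hle => ?_⟩
  have := (rSeq_strictMono A hD).monotone (show i + 1 ≤ i' from hlt)
  omega

theorem encG_rSeq (hD : 0 < D) {i : ℕ} (hi : i ≤ 2 ^ k - 1) :
    encG D A (rSeq D A i) = wSeq D A i := by
  have hb := blockG_eq A hD hi le_rfl (rSeq_strictMono A hD (Nat.lt_succ_self i))
  simp only [encG, hb, if_true]

/-- In `hPos` the list of positions is coerced to a list of natural numbers through the monad
structure of lists, which amounts to `List.map`. -/
theorem hPos_eq (D i m : ℕ) :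
    hPos D A i m = ((hIdx D A i).map (Fin.val : Fin (2 * n + 3 * D) → ℕ)).getD (m - 1) 0 := by
  rw [hPos]
  congr 1
  simp [← List.map_eq_flatMap]

/-- The codewords in block `i` are the cuts of `w_i` into `w_{i+1}`, indexed by the number of
differences before the crossover. Positions `q` with the same count give the same word, and the
last cut is `w_{i+1}`, the first word of the next block. -/
theorem encG_add_blockCount (hD : 0 < D) {i : ℕ} (hi : i < 2 ^ k - 1) (q : ℕ) :
    encG D A (rSeq D A i + blockCount D A i q) = blockCut D A i q := by
  have hle : blockCount D A i q ≤ hammingDist (wSeq D A i) (wSeq D A (i + 1)) := by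
    rw [← cutCount_of_le _ _ (le_max_right q (2 * n + 3 * D))]
    exact cutCount_mono _ _ (le_max_left _ _)
  rcases Nat.eq_zero_or_pos (blockCount D A i q) with h0 | hpos
  · rw [h0, add_zero, encG_rSeq A hD hi.le, blockCut,
      cut_eq_cut_of_cutCount_eq _ _ (h0.trans (cutCount_zero _ _).symm), cut_zero]
  rcases hle.eq_or_lt with hend | hlt
  · rw [hend, ← rSeq_succ, encG_rSeq A hD hi, blockCut,
      cut_eq_cut_of_cutCount_eq _ _ (hend.trans (cutCount_of_le _ _ le_rfl).symm),
      cut_of_le _ _ le_rfl]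
  have hb := blockG_eq A hD (j := rSeq D A i + blockCount D A i q) hi.le (by omega)
    (by rw [rSeq_succ]; omega)
  -- otherwise `h_{i,m}` is the entry with index `m - 1` of the list `L` of all differences
  set m := blockCount D A i q with hm
  set L := (List.finRange (2 * n + 3 * D)).filter
    fun t => wSeq D A i t ≠ wSeq D A (i + 1) t with hL
  have hmono : StrictMono L.get :=
    (List.pairwise_iff_get.1 ((List.pairwise_lt_finRange _).filter _))
  have hrange : ∀ t, (∃ s, L.get s = t) ↔ 0 ≤ (t : ℕ) ∧ (t : ℕ) < 2 * n + 3 * D ∧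
      wSeq D A i t ≠ wSeq D A (i + 1) t := fun t => by
    rw [← List.mem_iff_get, hL, List.mem_filter]
    simp
  obtain ⟨v, hv, hcv, hall⟩ := exists_cutCount_eq_add hmono hrange (Nat.zero_le _) le_rfl
  rw [cutCount_zero, zero_add, cutCount_of_le _ _ le_rfl] at hcv
  have hmL : m < L.length := by omega
  have hpos' : hPos D A i m = (L.get ⟨m - 1, by omega⟩ : ℕ) := by
    have hlen : m - 1 < L.dropLast.length := by rw [List.length_dropLast]; omega
    rw [hPos_eq, hIdx, ← hL, List.getD_eq_getElem _ _ (by rw [List.length_map]; exact hlen),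
      List.getElem_map, List.getElem_dropLast]
    rfl
  set q' := hPos D A i m + 1 with hq'
  obtain ⟨v', hv', hcv', hall'⟩ := exists_cutCount_eq_add hmono hrange (q := q') (Nat.zero_le _)
    (by rw [hq', hpos']; exact (L.get _).isLt)
  have hv'm : v' = m := by
    have h1 := (hall' ⟨m - 1, by omega⟩).1 (by rw [hq', hpos']; exact Nat.lt_succ_self _)
    have h2 : ¬ (m < v') := fun h => by
      have h3 := (hall' ⟨m, hmL⟩).2 h
      have h4 : L.get ⟨m - 1, by omega⟩ < L.get ⟨m, hmL⟩ :=
        hmono (by rw [Fin.mk_lt_mk]; omega)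
      rw [hq', hpos'] at h3
      exact absurd h4 (not_lt.2 (Nat.lt_succ_iff.1 h3))
    simp only at h1
    omega
  have hcut : blockCut D A i q = blockCut D A i q' :=
    cut_eq_cut_of_cutCount_eq _ _ (by rw [hcv', cutCount_zero, zero_add, hv'm]; rfl)
  rw [hcut]
  simp only [encG, hb]
  rw [if_neg (by omega), Nat.add_sub_cancel_left]
  funext t
  simp only [blockCut, cut, hq', Nat.lt_succ_iff]

/-- Every codeword lies in the block of some `w_i` and `w_{i+1}`. The codeword `w_{i+1}` is
included in this block, as its last cut, so that no block of its own is needed for the last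
codeword. -/
theorem exists_eq_add_blockCount (hk : 0 < k) {j : ℕ} (hj : j < sizeG D A) :
    ∃ i < 2 ^ k - 1, ∃ q ≤ 2 * n + 3 * D, j = rSeq D A i + blockCount D A i q := by
  have h2 : 2 ≤ 2 ^ k := by
    calc 2 = 2 ^ 1 := rfl
      _ ≤ 2 ^ k := Nat.pow_le_pow_right (by norm_num) hk
  have hex : ∃ i, j ≤ rSeq D A (i + 1) := ⟨2 ^ k - 2, by
    rw [show 2 ^ k - 2 + 1 = 2 ^ k - 1 by omega]
    exact Nat.lt_succ_iff.1 hj⟩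
  classical
  refine ⟨Nat.find hex, ?_, ?_⟩
  · have := Nat.find_min' hex (m := 2 ^ k - 2) (by
      rw [show 2 ^ k - 2 + 1 = 2 ^ k - 1 by omega]
      exact Nat.lt_succ_iff.1 hj)
    omega
  · have hle := Nat.find_spec hex
    have hge : rSeq D A (Nat.find hex) ≤ j := by
      rcases Nat.eq_zero_or_pos (Nat.find hex) with h0 | hpos
      · rw [h0]
        exact Nat.zero_le _
      · have := Nat.find_min hex (m := Nat.find hex - 1) (by omega)
        rw [Nat.sub_add_cancel hpos] at this
        omega
    rw [rSeq_succ, ← cutCount_of_le _ _ (le_refl (2 * n + 3 * D))] at hle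
    obtain ⟨q, hq, hc⟩ := exists_cutCount_eq _ _ (m := j - rSeq D A (Nat.find hex)) _
      (Nat.sub_le_iff_le_add'.2 hle)
    exact ⟨q, hq, by rw [blockCount, hc]; omega⟩

end Gray

/-! ### The three cases of the decoder -/

section Decoder

variable {n k D : ℕ} (A : Matrix (Fin k) (Fin n) (ZMod 2))

/-- `j` is the index of a word in the block of `w_i` and `w_{i+1}` whose crossover lies between
`lo` and `hi` and which is closest to `x` among all such words. -/
def IsClosestCut (x : Fin (2 * n + 3 * D) → ZMod 2) (i lo hi j : ℕ) : Prop :=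
  ∃ q, lo ≤ q ∧ q ≤ hi ∧ j = rSeq D A i + blockCount D A i q ∧
    ∀ q', lo ≤ q' → q' ≤ hi →
      hammingDist x (blockCut D A i q) ≤ hammingDist x (blockCut D A i q')

/-- `j'` is acceptable as an estimate of `j`: its codeword is at least as close to `x`, and the
distance of the two codewords is `|j - j'|`. -/
def IsGoodEstimate (x : Fin (2 * n + 3 * D) → ZMod 2) (j j' : ℕ) : Prop :=
  hammingDist x (encG D A j') ≤ hammingDist x (encG D A j) ∧
    hammingDist (encG D A j) (encG D A j') = ((j : ℤ) - j').natAbs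

variable {A}

/-- A closest cut in a range is a good estimate of every index whose cut lies in this range. -/
theorem IsClosestCut.isGoodEstimate {x : Fin (2 * n + 3 * D) → ZMod 2} {i lo hi j' q : ℕ}
    (h : IsClosestCut A x i lo hi j') (hD : 0 < D) (hi' : i < 2 ^ k - 1) (hlo : lo ≤ q)
    (hhi : q ≤ hi) : IsGoodEstimate A x (rSeq D A i + blockCount D A i q) j' := by
  obtain ⟨q', h1, h2, rfl, hmin⟩ := h
  rw [IsGoodEstimate, encG_add_blockCount A hD hi', encG_add_blockCount A hD hi']
  refine ⟨hmin q hlo hhi, ?_⟩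
  rw [blockCut, blockCut, hammingDist_cut_cut_natAbs]
  congr 1
  push_cast [blockCount]
  ring

theorem isClosestCut_decU {i lo hi l : ℕ} (hlh : lo ≤ hi) {e : Fin l → Fin (2 * n + 3 * D)}
    (he : StrictMono e)
    (hrange : ∀ t, (∃ s, e s = t) ↔
      lo ≤ (t : ℕ) ∧ (t : ℕ) < hi ∧ wSeq D A i t ≠ wSeq D A (i + 1) t)
    (x : Fin (2 * n + 3 * D) → ZMod 2) :
    IsClosestCut A x i lo hi
      (rSeq D A i + blockCount D A i lo + decU fun s => x (e s) + wSeq D A i (e s)) := by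
  obtain ⟨q, h1, h2, h3, h4⟩ := exists_cut_eq_decU hlh he hrange x
  exact ⟨q, h1, h2, by rw [blockCount, blockCount, h3, ← add_assoc], h4⟩

/-- The last position is in the third repetition block, so it is always the difference that `h_i`
omits. -/
theorem mem_hIdx_iff (hD : 0 < D) (i : ℕ) (t : Fin (2 * n + 3 * D)) :
    t ∈ hIdx D A i ↔ wSeq D A i t ≠ wSeq D A (i + 1) t ∧ (t : ℕ) < 2 * n + 3 * D - 1 := by
  set a : Fin (2 * n + 3 * D) := ⟨2 * n + 3 * D - 1, by omega⟩ with ha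
  have hlast : ∀ i, wSeq D A i a = (i : ZMod 2) := fun i => by
    rw [← congrFun (s3_wSeq D A i) ⟨D - 1, by omega⟩, s3, sub]
    congr 1
    exact Fin.ext (by simp [ha]; omega)
  rw [hIdx, mem_dropLast_iff_of_pairwise_lt (a := a)
    ((List.pairwise_lt_finRange _).filter _)]
  · simp [ha, Fin.lt_def]
  · simp only [List.mem_filter, List.mem_finRange, true_and, decide_eq_true_eq, hlast]
    exact natCast_ne_succ i
  · intro t _
    exact Fin.le_def.2 (by simp only [ha]; omega)

theorem hIdx_filter_get_strictMono (i : ℕ) (P : Fin (2 * n + 3 * D) → Bool) :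
    StrictMono ((hIdx D A i).filter P).get :=
  List.pairwise_iff_get.1
    ((((List.pairwise_lt_finRange _).filter _).sublist (List.dropLast_sublist _)).filter P)

theorem decCase1_isClosestCut (hD : 0 < D) {i : ℕ} (hi : i < 2 ^ k - 1)
    (x : Fin (2 * n + 3 * D) → ZMod 2) :
    IsClosestCut A x i (D + n) (2 * n + 3 * D - 1) (decCase1 D A x (brc k (i + 1))) := by
  have h := isClosestCut_decU (A := A) (i := i) (lo := D + n) (hi := 2 * n + 3 * D - 1) (by omega)
    (hIdx_filter_get_strictMono i fun l => decide (n + D ≤ (l : ℕ))) (fun t => by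
      rw [← List.mem_iff_get, List.mem_filter, mem_hIdx_iff hD, decide_eq_true_eq, add_comm D n]
      tauto) x
  convert h using 1
  unfold decCase1
  rw [brcInv_brc (show i + 1 < 2 ^ k by omega)]
  simp only [Nat.succ_ne_zero, if_false,
    Nat.add_sub_cancel, ← cSeq_eq_encC A (show i + 1 < 2 ^ k by omega),
    ← cSeq_eq_encC A (show i < 2 ^ k by omega), computeR_eq_rSeq D A (show i < 2 ^ k by omega),
    blockCount_c1]
  have : ∀ u r c : ℕ, u + D + c + r = r + (D + c) + u := fun u r c => by ring
  exact this _ _ _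

theorem decCase2_isClosestCut (hD : 0 < D) {i : ℕ} (hi : i < 2 ^ k - 1)
    (x : Fin (2 * n + 3 * D) → ZMod 2) :
    IsClosestCut A x i 0 (2 * D + n) (decCase2 D A x (brc k i)) := by
  have h := isClosestCut_decU (A := A) (i := i) (lo := 0) (hi := 2 * D + n) (by omega)
    (hIdx_filter_get_strictMono i fun l => decide ((l : ℕ) < n + 2 * D)) (fun t => by
      rw [← List.mem_iff_get, List.mem_filter, mem_hIdx_iff hD, decide_eq_true_eq]
      constructor
      · exact fun h => ⟨Nat.zero_le _, by omega, h.1.1⟩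
      · exact fun h => ⟨⟨h.2.2, by omega⟩, by omega⟩) x
  convert h using 1
  unfold decCase2
  rw [brcInv_brc (show i < 2 ^ k by omega)]
  simp only [hi.ne, if_false,
    ← cSeq_eq_encC A (show i < 2 ^ k by omega), computeR_eq_rSeq D A (show i < 2 ^ k by omega)]
  rw [blockCount, cutCount_zero, add_zero, add_comm]
  rfl

/-- The first estimate in Case 3 looks for a crossover in the first repetition block. -/
theorem isClosestCut_decU_s1 (i : ℕ) (x : Fin (2 * n + 3 * D) → ZMod 2) :
    IsClosestCut A x i 0 D (rSeq D A i + decU (s1 x + fun _ => (i : ZMod 2))) := by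
  have h := isClosestCut_decU (A := A) (i := i) (lo := 0) (hi := D) (by omega)
    (e := fun s : Fin D => ⟨s, by omega⟩) (fun a b hab => hab) (fun t => by
      constructor
      · rintro ⟨s, rfl⟩
        refine ⟨Nat.zero_le _, s.isLt, ?_⟩
        have h1 : ∀ i, wSeq D A i ⟨s, by omega⟩ = (i : ZMod 2) := fun i => by
          rw [← congrFun (s1_wSeq D A i) s, s1, sub]
          simp
        rw [h1, h1]
        exact natCast_ne_succ i
      · rintro ⟨_, h2, _⟩
        exact ⟨⟨t, h2⟩, rfl⟩) x
  convert h using 1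
  rw [blockCount, cutCount_zero, add_zero, ← s1_wSeq D A i]
  congr 2
  funext s
  simp [s1, sub]

/-- The second estimate in Case 3 looks for a crossover in the third repetition block. -/
theorem isClosestCut_decU_s3 (i : ℕ) (x : Fin (2 * n + 3 * D) → ZMod 2) :
    IsClosestCut A x i (2 * D + 2 * n) (2 * n + 3 * D)
      (decU (s3 x + fun _ => (i : ZMod 2)) + 2 * D +
        2 * hammingDist (cSeq A i) (cSeq A (i + 1)) + rSeq D A i) := by
  have h := isClosestCut_decU (A := A) (i := i) (lo := 2 * D + 2 * n) (hi := 2 * n + 3 * D)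
    (by omega) (e := fun s : Fin D => ⟨2 * D + 2 * n + s, by omega⟩)
    (fun a b hab => by simpa using hab) (fun t => by
      constructor
      · rintro ⟨s, rfl⟩
        refine ⟨Nat.le_add_right _ _, by simp only; omega, ?_⟩
        have h1 : ∀ i, wSeq D A i ⟨2 * D + 2 * n + s, by omega⟩ = (i : ZMod 2) := fun i => by
          rw [← congrFun (s3_wSeq D A i) s, s3, sub]
        rw [h1, h1]
        exact natCast_ne_succ i
      · rintro ⟨h1, h2, _⟩
        exact ⟨⟨t - (2 * D + 2 * n), by omega⟩, Fin.ext (by simp only; omega)⟩) x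
  convert h using 1
  rw [blockCount_c2, ← s3_wSeq D A i]
  have : ∀ u r c : ℕ, u + 2 * D + c + r = r + (2 * D + c) + u := fun u r c => by ring
  exact this _ _ _

/-- The distance from a word of the block before `w_i`, with crossover in the third repetition
block, to a word of the block after `w_i`, with crossover in the first one. -/
theorem hammingDist_blockCut_succ {i q q' : ℕ} (hq : 2 * D + 2 * n ≤ q) (hq' : q' ≤ D) :
    rSeq D A i + blockCount D A i q +
        hammingDist (blockCut D A i q) (blockCut D A (i + 1) q') =
      rSeq D A (i + 1) + blockCount D A (i + 1) q' := by
  have h1 : hammingDist (blockCut D A i q) (blockCut D A (i + 1) q') =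
      hammingDist (blockCut D A i q) (wSeq D A (i + 1)) +
        hammingDist (wSeq D A (i + 1)) (blockCut D A (i + 1) q') := by
    unfold hammingDist
    rw [← Finset.card_union_of_disjoint]
    · congr 1
      ext t
      rw [Finset.mem_union, Finset.mem_filter, Finset.mem_filter, Finset.mem_filter]
      simp only [Finset.mem_univ, true_and, blockCut, cut]
      by_cases ht : (t : ℕ) < q
      · simp [ht]
      · have ht' : ¬ (t : ℕ) < q' := by omega
        simp [ht, ht']
    · rw [Finset.disjoint_filter]
      intro t _ h2 h3
      simp only [blockCut, cut] at h2 h3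
      by_cases ht : (t : ℕ) < q
      · simp [ht] at h2
      · have ht' : ¬ (t : ℕ) < q' := by omega
        simp [ht'] at h3
  have h2 := hammingDist_cut_cut (wSeq D A i) (wSeq D A (i + 1))
    (le_max_left q (2 * n + 3 * D))
  rw [cut_of_le _ _ (le_max_right _ _), cutCount_of_le _ _ (le_max_right _ _)] at h2
  have h3 := hammingDist_cut_cut (wSeq D A (i + 1)) (wSeq D A (i + 1 + 1)) (Nat.zero_le q')
  rw [cut_zero, cutCount_zero, zero_add] at h3
  rw [h1, rSeq_succ]
  unfold blockCut blockCount
  omega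

end Decoder

/-! ### The decoder returns a good estimate -/

section Decoder

variable {n k D : ℕ} {A : Matrix (Fin k) (Fin n) (ZMod 2)}
  {decC : (Fin n → ZMod 2) → (Fin k → ZMod 2)} {coin : Fin 3 → ZMod 2}
  {x : Fin (2 * n + 3 * D) → ZMod 2}

/-- In contrast to `encG_add_blockCount`, the index `i` may be the last one here: then the bound
on `j` leaves only the cut `w_i` itself. -/
theorem encG_eq_blockCut (hD : 0 < D) {i q j : ℕ} (hi : i ≤ 2 ^ k - 1)
    (hj : j = rSeq D A i + blockCount D A i q) (hN : j < sizeG D A) :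
    encG D A j = blockCut D A i q := by
  rcases hi.lt_or_eq with hlt | rfl
  · rw [hj, encG_add_blockCount A hD hlt]
  · rw [sizeG] at hN
    have h0 : blockCount D A (2 ^ k - 1) q = 0 := by omega
    rw [hj, h0, add_zero, encG_rSeq A hD le_rfl, blockCut,
      cut_eq_cut_of_cutCount_eq _ _ (h0.trans (cutCount_zero _ _).symm), cut_zero]

theorem decCase3_zero :
    IsClosestCut A x 0 0 D (decCase3 D A x ((0 : ℕ) : ZMod 2) (brc k 0)) := by
  convert isClosestCut_decU_s1 (A := A) 0 x using 1
  unfold decCase3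
  rw [brcInv_brc (show 0 < 2 ^ k by positivity), if_pos rfl, computeR_eq_rSeq D A (by positivity),
    add_comm]

theorem decCase3_succ {i : ℕ} (hi : i + 1 < 2 ^ k) :
    ∃ j₁ j₂, IsClosestCut A x (i + 1) 0 D j₁ ∧
      IsClosestCut A x i (2 * D + 2 * n) (2 * n + 3 * D) j₂ ∧
      decCase3 D A x ((i + 1 : ℕ) : ZMod 2) (brc k (i + 1)) =
        if sizeG D A ≤ j₁ then j₂
        else if hammingDist x (encG D A j₁) ≤ hammingDist x (encG D A j₂) then j₁ else j₂ := by
  refine ⟨_, _, isClosestCut_decU_s1 (i + 1) x, isClosestCut_decU_s3 i x, ?_⟩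
  have h2 : ((i + 1 : ℕ) : ZMod 2) + 1 = i := by
    rw [Nat.cast_succ]
    exact (by decide : ∀ b : ZMod 2, b + 1 + 1 = b) i
  unfold decCase3
  rw [brcInv_brc hi]
  simp only [Nat.succ_ne_zero, if_false, Nat.add_sub_cancel, ← cSeq_eq_encC A hi,
    ← cSeq_eq_encC A (show i < 2 ^ k by omega), computeR_eq_rSeq D A (show i < 2 ^ k by omega),
    computeR_eq_rSeq D A hi, h2]
  rw [add_comm (decU (s1 x + fun _ => ((i + 1 : ℕ) : ZMod 2)))]

/-- Case 3 with the crossover in the first repetition block: the first estimate competes with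
`g_j`, and the second one replaces it only if it is closer. -/
theorem decCase3_isGoodEstimate_left (hD : 0 < D) {i q : ℕ} (hi : i < 2 ^ k - 1) (hq : q ≤ D) :
    IsGoodEstimate A x (rSeq D A i + blockCount D A i q)
      (decCase3 D A x (i : ZMod 2) (brc k i)) := by
  cases i with
  | zero => exact decCase3_zero.isGoodEstimate hD hi (Nat.zero_le _) hq
  | succ i =>
    obtain ⟨j₁, j₂, h1, h2, heq⟩ := decCase3_succ (A := A) (x := x) (show i + 1 < 2 ^ k by omega)
    have hgood := h1.isGoodEstimate hD hi (Nat.zero_le _) hq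
    have hN : j₁ < sizeG D A := by
      obtain ⟨q₁, _, hq₁, rfl, _⟩ := h1
      have hle : blockCount D A (i + 1) q₁ ≤ D :=
        (cutCount_mono _ _ hq₁).trans (blockCount_s1 D A (i + 1)).le
      have := (rSeq_strictMono A hD).monotone (show i + 1 + 1 ≤ 2 ^ k - 1 from hi)
      rw [rSeq_succ, hammingDist_wSeq_succ] at this
      rw [sizeG]
      omega
    rw [heq, if_neg (by omega)]
    split_ifs with hle
    · exact hgood
    · refine ⟨(not_le.1 hle).le.trans hgood.1, ?_⟩
      obtain ⟨q₂, hq₂, _, rfl, _⟩ := h2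
      rw [encG_add_blockCount A hD hi, encG_add_blockCount A hD (show i < 2 ^ k - 1 by omega),
        hammingDist_comm]
      have := hammingDist_blockCut_succ (A := A) (i := i) hq₂ hq
      omega

/-- Case 3 with the crossover in the third repetition block: now the second estimate competes with
`g_j`. The first one is discarded if it is not an index at all. -/
theorem decCase3_isGoodEstimate_right (hD : 0 < D) {i q : ℕ} (hi : i < 2 ^ k - 1)
    (hlo : 2 * D + 2 * n ≤ q) (hhi : q ≤ 2 * n + 3 * D) :
    IsGoodEstimate A x (rSeq D A i + blockCount D A i q)
      (decCase3 D A x ((i + 1 : ℕ) : ZMod 2) (brc k (i + 1))) := by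
  obtain ⟨j₁, j₂, h1, h2, heq⟩ := decCase3_succ (A := A) (x := x) (show i + 1 < 2 ^ k by omega)
  have hgood := h2.isGoodEstimate hD hi hlo hhi
  rw [heq]
  split_ifs with hN hle
  · exact hgood
  · refine ⟨hle.trans hgood.1, ?_⟩
    obtain ⟨q₁, _, hq₁, hj₁, _⟩ := h1
    rw [encG_add_blockCount A hD hi,
      encG_eq_blockCut hD (show i + 1 ≤ 2 ^ k - 1 from hi) hj₁ (not_le.1 hN), hj₁]
    have := hammingDist_blockCut_succ (A := A) (i := i) hlo hq₁
    omega
  · exact hgood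

theorem decG_of_maj_case1 {b b' : ZMod 2} (hb : b ≠ b') (h1 : maj (coin 0) (s1 x) = b')
    (h2 : maj (coin 1) (s2 x) = b') (h3 : maj (coin 2) (s3 x) = b) :
    decG D A decC coin x = decCase1 D A x (decC (c1 x)) := by
  simp only [decG, h1, h2, h3]
  exact if_pos ((by decide : ∀ b b' : ZMod 2, b ≠ b' →
    (b', b', b) = ((1, 1, 0) : ZMod 2 × ZMod 2 × ZMod 2) ∨ (b', b', b) = (0, 0, 1)) b b' hb)

theorem decG_of_maj_case2 {b b' : ZMod 2} (hb : b ≠ b') (h1 : maj (coin 0) (s1 x) = b')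
    (h2 : maj (coin 1) (s2 x) = b) (h3 : maj (coin 2) (s3 x) = b) :
    decG D A decC coin x = decCase2 D A x (decC (c2 x)) := by
  have hn : ∀ b b' : ZMod 2, b ≠ b' →
    ¬ ((b', b, b) = ((1, 1, 0) : ZMod 2 × ZMod 2 × ZMod 2) ∨ (b', b, b) = (0, 0, 1)) := by decide
  have hp : ∀ b b' : ZMod 2, b ≠ b' →
    (b', b, b) = ((0, 1, 1) : ZMod 2 × ZMod 2 × ZMod 2) ∨ (b', b, b) = (1, 0, 0) := by decide
  simp only [decG, h1, h2, h3]
  rw [if_neg (hn b b' hb), if_pos (hp b b' hb)]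

theorem decG_of_maj_case3 {b : ZMod 2} (h1 : maj (coin 0) (s1 x) = b)
    (h2 : maj (coin 1) (s2 x) = b) (h3 : maj (coin 2) (s3 x) = b) :
    decG D A decC coin x = decCase3 D A x b (decC (c1 x)) := by
  have hb : b = 0 ∨ b = 1 := (by decide : ∀ b : ZMod 2, b = 0 ∨ b = 1) b
  simp only [decG, h1, h2, h3]
  rcases hb with rfl | rfl <;> simp

/-- If no majority vote errs on an unmixed repetition block, and the base decoder does not err on
an unmixed codeword, then the decoder returns a good estimate. The crossover of `g_j` lies in one
of the five blocks, and the other four are unmixed. -/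
theorem decG_isGoodEstimate (hD : 0 < D) (hk : 0 < k) {j : ℕ} (hj : j < sizeG D A)
    (h1 : ∀ b, s1 (encG D A j) = (fun _ => b) → maj (coin 0) (s1 x) = b)
    (h2 : ∀ b, s2 (encG D A j) = (fun _ => b) → maj (coin 1) (s2 x) = b)
    (h3 : ∀ b, s3 (encG D A j) = (fun _ => b) → maj (coin 2) (s3 x) = b)
    (hc1 : ∀ v, c1 (encG D A j) = encC A v → decC (c1 x) = v)
    (hc2 : ∀ v, c2 (encG D A j) = encC A v → decC (c2 x) = v) :
    IsGoodEstimate A x j (decG D A decC coin x) := by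
  obtain ⟨i, hi, q, hq, rfl⟩ := exists_eq_add_blockCount A hk hj
  rw [encG_add_blockCount A hD hi] at h1 h2 h3 hc1 hc2
  have hik : i < 2 ^ k := by omega
  have hik' : i + 1 < 2 ^ k := by omega
  have hne := natCast_ne_succ i
  have bits : ∀ b : ZMod 2, b = i ∨ b = (i + 1 : ℕ) := fun b =>
    (by decide : ∀ a a' : ZMod 2, a ≠ a' → ∀ b, b = a ∨ b = a') _ _ hne b
  have h1' : D ≤ q → maj (coin 0) (s1 x) = (i + 1 : ℕ) := fun h => h1 _ <|
    (sub_cut_of_le _ _ _ (by omega)).trans (s1_wSeq D A (i + 1))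
  have h2l : q ≤ D + n → maj (coin 1) (s2 x) = i := fun h => h2 _ <|
    (sub_cut_of_ge _ _ _ h).trans (s2_wSeq D A i)
  have h2r : 2 * D + n ≤ q → maj (coin 1) (s2 x) = (i + 1 : ℕ) := fun h => h2 _ <|
    (sub_cut_of_le _ _ _ (by omega)).trans (s2_wSeq D A (i + 1))
  have h3l : q ≤ 2 * D + 2 * n → maj (coin 2) (s3 x) = i := fun h => h3 _ <|
    (sub_cut_of_ge _ _ _ h).trans (s3_wSeq D A i)
  have h3r : 2 * n + 3 * D ≤ q → maj (coin 2) (s3 x) = (i + 1 : ℕ) := fun h => h3 _ <|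
    (sub_cut_of_le _ _ _ (by omega)).trans (s3_wSeq D A (i + 1))
  have hc1l : q ≤ D → decC (c1 x) = brc k i := fun h => hc1 _ <|
    (sub_cut_of_ge _ _ _ h).trans ((c1_wSeq D A i).trans (cSeq_eq_encC A hik))
  have hc1r : D + n ≤ q → decC (c1 x) = brc k (i + 1) := fun h => hc1 _ <|
    (sub_cut_of_le _ _ _ h).trans ((c1_wSeq D A (i + 1)).trans (cSeq_eq_encC A hik'))
  have hc2l : q ≤ 2 * D + n → decC (c2 x) = brc k i := fun h => hc2 _ <|
    (sub_cut_of_ge _ _ _ h).trans ((c2_wSeq D A i).trans (cSeq_eq_encC A hik))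
  -- the two cases in which the parity change is seen between the repetition blocks
  have case1 : D + n ≤ q → q ≤ 2 * n + 3 * D - 1 → maj (coin 1) (s2 x) = (i + 1 : ℕ) →
      maj (coin 2) (s3 x) = i →
      IsGoodEstimate A x (rSeq D A i + blockCount D A i q) (decG D A decC coin x) := by
    intro hq1 hq2 hm2 hm3
    rw [decG_of_maj_case1 hne (h1' (by omega)) hm2 hm3, hc1r hq1]
    exact (decCase1_isClosestCut hD hi x).isGoodEstimate hD hi hq1 hq2
  have case2 : q ≤ 2 * D + n → maj (coin 0) (s1 x) = (i + 1 : ℕ) → maj (coin 1) (s2 x) = i →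
      IsGoodEstimate A x (rSeq D A i + blockCount D A i q) (decG D A decC coin x) := by
    intro hq1 hm1 hm2
    rw [decG_of_maj_case2 hne hm1 hm2 (h3l (by omega)), hc2l hq1]
    exact (decCase2_isClosestCut hD hi x).isGoodEstimate hD hi (Nat.zero_le _) hq1
  rcases le_or_gt q D with hqD | hqD
  · rcases bits (maj (coin 0) (s1 x)) with hm | hm
    · rw [decG_of_maj_case3 hm (h2l (by omega)) (h3l (by omega)), hc1l hqD]
      exact decCase3_isGoodEstimate_left hD hi hqD
    · exact case2 (by omega) hm (h2l (by omega))
  rcases le_or_gt q (D + n) with hqc1 | hqc1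
  · exact case2 (by omega) (h1' hqD.le) (h2l hqc1)
  rcases le_or_gt q (2 * D + n) with hqs2 | hqs2
  · rcases bits (maj (coin 1) (s2 x)) with hm | hm
    · exact case2 hqs2 (h1' hqD.le) hm
    · exact case1 hqc1.le (by omega) hm (h3l (by omega))
  rcases le_or_gt q (2 * D + 2 * n) with hqc2 | hqc2
  · exact case1 hqc1.le (by omega) (h2r hqs2.le) (h3l hqc2)
  · rcases bits (maj (coin 2) (s3 x)) with hm | hm
    · -- at the very end of the block `s_3` is unmixed as well, and this case does not arise
      have hqd : q ≠ 2 * n + 3 * D := fun h => hne (hm.symm.trans (h3r h.ge))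
      exact case1 hqc1.le (by omega) (h2r hqs2.le) hm
    · rw [decG_of_maj_case3 (h1' hqD.le) (h2r hqs2.le) hm, hc1r hqc1.le]
      exact decCase3_isGoodEstimate_right hD hi hqc2.le hq

end Decoder

/-! ### The union bound -/

theorem hammingDist_eq_hammingNorm_add {d : ℕ} (w w' : Fin d → ZMod 2) :
    hammingDist w w' = hammingNorm (w + w') := by
  have h : ∀ a b : ZMod 2, a ≠ b ↔ a + b ≠ 0 := by decide
  rw [hammingDist, hammingNorm]
  congr 1
  ext t
  rw [Finset.mem_filter, Finset.mem_filter, Pi.add_apply, h]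

section Union

variable {p : ℝ} {n k d D : ℕ} {A : Matrix (Fin k) (Fin n) (ZMod 2)}
  {decC : (Fin n → ZMod 2) → (Fin k → ZMod 2)}

theorem prob_sub_maj_le (h0 : 0 < p) (h1 : p ≤ 1 / 2) (hD : 0 < D)
    (hdist : ∃ v v', v ≠ v' ∧ hammingDist (encC A v) (encC A v') = D) (a : ℕ) (h : a + D ≤ d)
    (g : Fin d → ZMod 2) (l : Fin 3) :
    prob (fun ω : (Fin d → ZMod 2) × (Fin 3 → ZMod 2) => berMass p ω.1 * berMass (1 / 2) ω.2)
      (fun ω => ∃ b, sub a D h g = (fun _ => b) ∧ maj (ω.2 l) (sub a D h (g + ω.1)) ≠ b) ≤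
        pFail p A decC := by
  have hμ : ∀ ω : (Fin d → ZMod 2) × (Fin 3 → ZMod 2),
      0 ≤ berMass p ω.1 * berMass (1 / 2) ω.2 := fun ω =>
    mul_nonneg (berMass_nonneg h0.le (by linarith) _)
      (berMass_nonneg (by norm_num) (by norm_num) _)
  have he : Function.Injective fun s : Fin D => (⟨a + s, by omega⟩ : Fin d) := fun s s' hs => by
    simpa [Fin.ext_iff] using hs
  refine le_trans (prob_mono hμ ?_) (prob_maj_ne_le_pFail h0 h1 hdist he (g ⟨a, by omega⟩) l)
  rintro ω ⟨b, hb, hm⟩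
  have hb0 : g ⟨a, by omega⟩ = b := congrFun hb ⟨0, hD⟩
  rw [hb0]
  convert hm using 3 with s
  rw [sub, Pi.add_apply, ← congrFun hb s, sub]

theorem prob_sub_decC_le (h0 : 0 ≤ p) (h1 : p ≤ 1) (hA : LinearIndependent (ZMod 2) A.row)
    (a : ℕ) (h : a + n ≤ d) (g : Fin d → ZMod 2) :
    prob (fun ω : (Fin d → ZMod 2) × (Fin 3 → ZMod 2) => berMass p ω.1 * berMass (1 / 2) ω.2)
      (fun ω => ∃ v, sub a n h g = encC A v ∧ decC (sub a n h (g + ω.1)) ≠ v) ≤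
        pFail p A decC := by
  rw [prob_prod_fst (berMass p) (sum_berMass _) fun η =>
    ∃ v, sub a n h g = encC A v ∧ decC (sub a n h (g + η)) ≠ v]
  by_cases hv : ∃ v, sub a n h g = encC A v
  · obtain ⟨v, hv⟩ := hv
    have he : Function.Injective fun s : Fin n => (⟨a + s, by omega⟩ : Fin d) :=
      fun s s' hs => by simpa [Fin.ext_iff] using hs
    refine le_trans ?_ (prob_decC_ne_le_pFail v)
    rw [← prob_berMass_comp he fun η : Fin n → ZMod 2 => decC (encC A v + η) ≠ v]
    refine prob_mono (berMass_nonneg h0 h1) ?_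
    rintro η ⟨v', hv', hdec⟩
    have hvv : v' = v := Matrix.vecMul_injective_iff.2 hA (hv'.symm.trans hv)
    subst hvv
    rw [← hv]
    exact hdec
  · refine le_of_eq_of_le ?_ (pFail_nonneg h0 h1)
    rw [prob_eq_sum]
    exact Finset.sum_eq_zero fun η _ => if_neg fun ⟨v, hv', _⟩ => hv ⟨v, hv'⟩

/-- The probability that `g'` is at least as close to the received word as the transmitted word
`g` decays exponentially in the distance of the two. -/
theorem prob_hammingDist_le (h0 : 0 < p) (h1 : p < 1 / 2) (g g' : Fin d → ZMod 2) :
    prob (fun ω : (Fin d → ZMod 2) × (Fin 3 → ZMod 2) => berMass p ω.1 * berMass (1 / 2) ω.2)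
      (fun ω => hammingDist (g + ω.1) g' ≤ hammingDist (g + ω.1) g) ≤
        Real.exp (-((1 - 2 * p) ^ 2 / (4 * p + 2))) ^ hammingDist g g' := by
  rw [prob_prod_fst (berMass p) (sum_berMass _) fun η =>
    hammingDist (g + η) g' ≤ hammingDist (g + η) g]
  have hg : ∀ η, hammingDist (g + η) g = hammingNorm η := fun η => by
    rw [hammingDist_eq_hammingNorm_add, add_right_comm, vec_add_self, zero_add]
  have hg' : ∀ η, hammingDist (g + η) g' = hammingNorm (η + (g + g')) := fun η => by
    rw [hammingDist_eq_hammingNorm_add]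
    congr 1
    abel
  simp only [hg, hg']
  refine (prob_shift_closer_le h0 h1.le (g + g')).trans ?_
  rw [← hammingDist_eq_hammingNorm_add]
  exact pow_le_pow_left₀ (by positivity) (two_mul_sqrt_le_exp h0 h1) _

end Union

end RobustGray

open RobustGray

theorem theorem1 (p : ℝ) (hp0 : 0 < p) (hp1 : p < 1 / 2) (n k : ℕ) (hk : 0 < k)
    (C : Submodule (ZMod 2) (Fin n → ZMod 2)) (A : Matrix (Fin k) (Fin n) (ZMod 2))
    (hA : RobustGray.IsGeneratorMatrix C A)
    (decC : (Fin n → ZMod 2) → (Fin k → ZMod 2))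
    (α γ : ℝ) (hα : α = (1 - 2 * p) ^ 2 / (4 * p + 2)) (hγ : γ = 2 / (1 - Real.exp (-α)))
    (j : ℕ) (hj : j < RobustGray.sizeG (RobustGray.minDist C) A) (t : ℝ) :
    RobustGray.errProb p (RobustGray.minDist C) A decC j t ≤
      γ * Real.exp (-(α * t)) + 5 * RobustGray.pFail p A decC := by
  classical

  have hαpos : 0 < α := by
    rw [hα]
    have : 0 < 1 - 2 * p := by linarith
    positivity
  have hP : 0 ≤ pFail p A decC := pFail_nonneg hp0.le (by linarith)
  obtain ⟨hD, hdist⟩ := exists_hammingDist_encC_eq_minDist hk hA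
  set D := minDist C
  set g := encG D A j with hg
  set μ : (Fin (2 * n + 3 * D) → ZMod 2) × (Fin 3 → ZMod 2) → ℝ :=
    fun ω => berMass p ω.1 * berMass (1 / 2) ω.2 with hμdef
  have hμ : ∀ ω, 0 ≤ μ ω := fun ω => mul_nonneg (berMass_nonneg hp0.le (by linarith) _)
    (berMass_nonneg (by norm_num) (by norm_num) _)
  rcases lt_or_ge t 0 with ht | ht
  · -- for negative `t` the right-hand side exceeds `1`
    have h1 : errProb p D A decC j t ≤ 1 := by
      refine (prob_le_sum hμ _).trans (le_of_eq ?_)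
      rw [Fintype.sum_prod_type]
      simp only [hμdef, ← Finset.mul_sum, sum_berMass, mul_one]
    have h2 : 1 ≤ γ := by
      have hx := Real.exp_pos (-α)
      have hx1 : Real.exp (-α) < 1 := Real.exp_lt_one_iff.2 (by linarith)
      rw [hγ, le_div_iff₀ (by linarith)]
      linarith
    have h3 : 1 ≤ Real.exp (-(α * t)) := Real.one_le_exp (by nlinarith)
    nlinarith
  -- the outputs far from `j` whose codewords are as far from `g_j` as their indices are from `j`
  set J : Finset ℕ := (Finset.univ.image
    fun ω : (Fin (2 * n + 3 * D) → ZMod 2) × (Fin 3 → ZMod 2) =>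
      decG D A decC ω.2 (g + ω.1)).filter
    fun j' => t < |(j : ℝ) - j'| ∧ hammingDist g (encG D A j') = ((j : ℤ) - j').natAbs with hJ
  set S₁ : _ × (Fin 3 → ZMod 2) → Prop := fun ω =>
    ∃ b, s1 g = (fun _ => b) ∧ maj (ω.2 0) (s1 (g + ω.1)) ≠ b with hS₁
  set S₂ : _ × (Fin 3 → ZMod 2) → Prop := fun ω =>
    ∃ b, s2 g = (fun _ => b) ∧ maj (ω.2 1) (s2 (g + ω.1)) ≠ b with hS₂
  set S₃ : _ × (Fin 3 → ZMod 2) → Prop := fun ω =>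
    ∃ b, s3 g = (fun _ => b) ∧ maj (ω.2 2) (s3 (g + ω.1)) ≠ b with hS₃
  set C₁ : _ × (Fin 3 → ZMod 2) → Prop := fun ω =>
    ∃ v, c1 g = encC A v ∧ decC (c1 (g + ω.1)) ≠ v with hC₁
  set C₂ : _ × (Fin 3 → ZMod 2) → Prop := fun ω =>
    ∃ v, c2 g = encC A v ∧ decC (c2 (g + ω.1)) ≠ v with hC₂
  set U : (Fin (2 * n + 3 * D) → ZMod 2) × (Fin 3 → ZMod 2) → Prop := fun ω => ∃ j' ∈ J,
    hammingDist (g + ω.1) (encG D A j') ≤ hammingDist (g + ω.1) g with hU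
  have hcover : errProb p D A decC j t ≤
      prob μ fun ω => U ω ∨ S₁ ω ∨ S₂ ω ∨ S₃ ω ∨ C₁ ω ∨ C₂ ω := by
    refine prob_mono hμ fun ω hω => ?_
    by_contra hnot
    simp only [hS₁, hS₂, hS₃, hC₁, hC₂, not_or, not_exists, not_and, not_not] at hnot
    obtain ⟨hnU, h1, h2, h3, h4, h5⟩ := hnot
    obtain ⟨hle, heq⟩ := decG_isGoodEstimate hD hk hj h1 h2 h3 h4 h5
    exact hnU
      ⟨_, Finset.mem_filter.2 ⟨Finset.mem_image_of_mem _ (Finset.mem_univ ω), hω, heq⟩, hle⟩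
  have hUle : prob μ U ≤ γ * Real.exp (-(α * t)) := by
    refine (prob_exists_le hμ J _).trans ?_
    rw [hγ]
    refine le_trans (Finset.sum_le_sum fun j' hj' => ?_)
      (sum_exp_dist_le hαpos ht j J fun j' hj' => (Finset.mem_filter.1 hj').2.1)
    rw [← (Finset.mem_filter.1 hj').2.2, hα]
    exact prob_hammingDist_le hp0 hp1 g _
  have e1 : prob μ S₁ ≤ pFail p A decC := prob_sub_maj_le hp0 hp1.le hD hdist _ _ g 0
  have e2 : prob μ S₂ ≤ pFail p A decC := prob_sub_maj_le hp0 hp1.le hD hdist _ _ g 1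
  have e3 : prob μ S₃ ≤ pFail p A decC := prob_sub_maj_le hp0 hp1.le hD hdist _ _ g 2
  have e4 : prob μ C₁ ≤ pFail p A decC := prob_sub_decC_le hp0.le (by linarith) hA.1 _ _ g
  have e5 : prob μ C₂ ≤ pFail p A decC := prob_sub_decC_le hp0.le (by linarith) hA.1 _ _ g
  have u1 := prob_or_le hμ U fun ω => S₁ ω ∨ S₂ ω ∨ S₃ ω ∨ C₁ ω ∨ C₂ ω
  have u2 := prob_or_le hμ S₁ fun ω => S₂ ω ∨ S₃ ω ∨ C₁ ω ∨ C₂ ω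
  have u3 := prob_or_le hμ S₂ fun ω => S₃ ω ∨ C₁ ω ∨ C₂ ω
  have u4 := prob_or_le hμ S₃ fun ω => C₁ ω ∨ C₂ ω
  have u5 := prob_or_le hμ C₁ C₂
  linarith
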